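/- Let $d,L\ge 1$ be integers and let $\Lambda=(\mathbb Z/L\mathbb Z)^d$ be the $d$-dimensional discrete torus of side length $L$. Let $\beta=(\beta_{ij})_{i,j\in\Lambda}$ be symmetric, nonnegative, translation-invariant edge weights, i.e. $\beta_{ij}=\beta_{ji}\ge 0$ and $\beta_{x+i,x+j}=\beta_{ij}$ (for instance constant nearest-neighbour weights), and let $h>0$. Arboreal gas. Let $\mathbb G=(\Lambda,E)$ be the graph with $ij\in E$ iff $i\ne j$ and $\beta_{ij}\ne 0$. The arboreal gas with constant external field $h$ is the probability measure on forests (acyclic subgraphs with vertex set $\Lambda$) $F$ of $\mathbb G$ with $$\mathbb P_{\beta,h}[F]\propto \prod_{ij\in F}\beta_{ij}\prod_{T\in F}(1+h|T|),$$ where $T$ runs over the trees (connected components) of $F$ and $|T|$ is the number of vertices of $T$. Let $\mathbb E_{\beta,h}$ be its expectation and $T_0$ the tree containing the vertex $0$. Sigma model. Let $\Omega^{2\Lambda}$ be the real Grassmann algebra with generators $(\xi_i,\eta_i)_{i\in\Lambda}$, and let $\partial_{\xi_i},\partial_{\eta_i}$ be the odd derivations dual to the generators. Set $z_i=1-\xi_i\eta_i$,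 $u_i\cdot u_j=-\xi_i\eta_j-\xi_j\eta_i-z_iz_j$, $(u_i-u_j)^2=u_i\cdot u_i+u_j\cdot u_j-2u_i\cdot u_j$, and $$[F]_0=\Big(\prod_{i\in\Lambda}\partial_{\eta_i}\partial_{\xi_i}\tfrac1{z_i}\Big)F,\qquad H_{\beta,h}=\tfrac14\sum_{i,j\in\Lambda}\beta_{ij}(u_i-u_j)^2+h\sum_{i\in\Lambda}(z_i-1),\qquad \langle F\rangle_{\beta,h}=\frac{[Fe^{-H_{\beta,h}}]_0}{[e^{-H_{\beta,h}}]_0}.$$ Fourier multiplier. Let $\Lambda^\star=\{\tfrac{2\pi}{L}k : k\in\{0,\dots,L-1\}^d\}$ and, representing points of $\Lambda$ by $\{0,\dots,L-1\}^d$ and writing $\cdot$ for the Euclidean inner product on $\mathbb R^d$, let $\lambda(p)=\sum_{j\in\Lambda}\beta_{0j}(1-\cos(p\cdot j))$ for $p\in\Lambda^\star$. Then $$\langle z_0\rangle_{\beta,h}=\mathbb E_{\beta,h}\Big[\frac{h|T_0|}{1+h|T_0|}\Big]\qquad\text{and}\qquad \frac{1}{\langle z_0\rangle_{\beta,h}}\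 \ge\ 1+\frac{1}{(2\pi L)^d}\sum_{p\in\Lambda^\star}\frac{1}{\lambda(p)+h}.$$ -/

import Mathlib

noncomputable section

namespace ArborealGas

/-! ### The arboreal gas with edge weights `β` and vertex weights `h` -/

section Forests

variable {Λ : Type*}

/-- The graph induced by symmetric edge weights: `ij` is an edge iff `i ≠ j` and `β_{ij} ≠ 0`. -/
def weightGraph (β : Sym2 Λ → ℝ) : SimpleGraph Λ where
  Adj i j := i ≠ j ∧ β s(i, j) ≠ 0
  symm := ⟨fun i j hij => ⟨hij.1.symm, by rw [Sym2.eq_swap]; exact hij.2⟩⟩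
  loopless := ⟨fun _ hi => hi.1 rfl⟩

variable [Fintype Λ]

open scoped Classical in
/-- The (spanning) forests of the graph induced by `β`: acyclic subgraphs with vertex set `Λ`. -/
def forests (β : Sym2 Λ → ℝ) : Finset (SimpleGraph Λ) :=
  Finset.univ.filter fun F => F ≤ weightGraph β ∧ F.IsAcyclic

open scoped Classical in
/-- The weight `∏_{ij ∈ F} β_{ij} ∏_{T ∈ F} (1 + ∑_{i ∈ T} h_i)` of a forest `F`,
where `T` runs over the trees (connected components) of `F`. -/
def forestWeight (β : Sym2 Λ → ℝ) (h : Λ → ℝ) (F : SimpleGraph Λ) : ℝ :=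
  (∏ e ∈ F.edgeFinset, β e) *
    ∏ T : F.ConnectedComponent, (1 + ∑ i ∈ Finset.univ.filter (fun i => i ∈ T.supp), h i)

/-- The partition function `Z_{β,h}` of the arboreal gas. -/
def partitionFunction (β : Sym2 Λ → ℝ) (h : Λ → ℝ) : ℝ :=
  ∑ F ∈ forests β, forestWeight β h F

/-- The expectation `𝔼_{β,h} X` of a function `X` of the random forest, whose law gives the
forest `F` the probability `forestWeight β h F / Z_{β,h}`. -/
def forestExpectation (β : Sym2 Λ → ℝ) (h : Λ → ℝ) (X : SimpleGraph Λ → ℝ) : ℝ :=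
  ∑ F ∈ forests β, forestWeight β h F / partitionFunction β h * X F


/-- The number `|T_i|` of vertices of the tree of `F` that contains the vertex `i`. -/
def treeSize (F : SimpleGraph Λ) (i : Λ) : ℕ :=
  (F.connectedComponentMk i).supp.ncard

end Forests

/-! ### The hyperbolic sigma model with values in `ℍ^{0|2}` -/

section SigmaModel

variable {Λ : Type*}

/-- The real Grassmann algebra `Ω^{2Λ}`, with two odd generators for each `i ∈ Λ`. -/
abbrev Grassmann (Λ : Type*) : Type _ := ExteriorAlgebra ℝ (Λ ⊕ Λ → ℝ)

/-- Products of two generators are even, hence central. -/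
theorem even_commute (a b : Λ ⊕ Λ → ℝ) (x : Grassmann Λ) :
    Commute (ExteriorAlgebra.ι ℝ a * ExteriorAlgebra.ι ℝ b) x := by
  have swap : ∀ p q : Λ ⊕ Λ → ℝ, ExteriorAlgebra.ι ℝ p * ExteriorAlgebra.ι ℝ q
      = -(ExteriorAlgebra.ι ℝ q * ExteriorAlgebra.ι ℝ p) := fun p q =>
    eq_neg_of_add_eq_zero_left (ExteriorAlgebra.ι_add_mul_swap p q)
  induction x using ExteriorAlgebra.induction with
  | algebraMap r => exact (Algebra.commutes r _).symm
  | ι m =>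
    change _ * _ = _ * _
    rw [mul_assoc, swap b m, mul_neg, ← mul_assoc, swap a m, neg_mul, neg_neg, mul_assoc]
  | mul x y hx hy => exact hx.mul_right hy
  | add x y hx hy => exact hx.add_right hy

theorem dual_commute (f g : Module.Dual ℝ (Λ ⊕ Λ → ℝ)) (F : Grassmann Λ) :
    CliffordAlgebra.contractLeft (Q := (0 : QuadraticForm ℝ (Λ ⊕ Λ → ℝ))) f
        (CliffordAlgebra.contractLeft g F)
      = -CliffordAlgebra.contractLeft g (CliffordAlgebra.contractLeft f F) :=
  CliffordAlgebra.contractLeft_comm _ _ F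

theorem contractLeft_mul_even (f : Module.Dual ℝ (Λ ⊕ Λ → ℝ)) (a b : Λ ⊕ Λ → ℝ)
    (ha : f a = 0) (hb : f b = 0) (F : Grassmann Λ) :
    CliffordAlgebra.contractLeft (Q := (0 : QuadraticForm ℝ (Λ ⊕ Λ → ℝ))) f
        (ExteriorAlgebra.ι ℝ a * ExteriorAlgebra.ι ℝ b * F)
      = ExteriorAlgebra.ι ℝ a * ExteriorAlgebra.ι ℝ b * CliffordAlgebra.contractLeft f F := by
  have h1 := CliffordAlgebra.contractLeft_ι_mul (Q := (0 : QuadraticForm ℝ (Λ ⊕ Λ → ℝ))) f a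
    (ExteriorAlgebra.ι ℝ b * F)
  have h2 := CliffordAlgebra.contractLeft_ι_mul (Q := (0 : QuadraticForm ℝ (Λ ⊕ Λ → ℝ))) f b F
  rw [ha, zero_smul, zero_sub] at h1
  rw [hb, zero_smul, zero_sub] at h2
  rw [mul_assoc, mul_assoc]
  refine h1.trans ?_
  change -(_ * CliffordAlgebra.contractLeft (Q := (0 : QuadraticForm ℝ (Λ ⊕ Λ → ℝ))) f
    (CliffordAlgebra.ι _ b * F)) = _
  rw [h2, mul_neg, neg_neg]

variable [DecidableEq Λ]

/-- The generator `ξ_i`. -/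
def xi (i : Λ) : Grassmann Λ := ExteriorAlgebra.ι ℝ (Pi.single (Sum.inl i) 1)

/-- The generator `η_i`. -/
def eta (i : Λ) : Grassmann Λ := ExteriorAlgebra.ι ℝ (Pi.single (Sum.inr i) 1)

/-- The odd derivation `∂_{ξ_i}`: contraction with the coordinate functional dual to `ξ_i`. -/
def dXi (i : Λ) : Module.End ℝ (Grassmann Λ) :=
  CliffordAlgebra.contractLeft (Q := (0 : QuadraticForm ℝ (Λ ⊕ Λ → ℝ)))
    (LinearMap.proj (Sum.inl i))

/-- The odd derivation `∂_{η_i}`: contraction with the coordinate functional dual to `η_i`. -/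
def dEta (i : Λ) : Module.End ℝ (Grassmann Λ) :=
  CliffordAlgebra.contractLeft (Q := (0 : QuadraticForm ℝ (Λ ⊕ Λ → ℝ)))
    (LinearMap.proj (Sum.inr i))

/-- `z_i = √(1 - 2 ξ_i η_i) = 1 - ξ_i η_i`. -/
def z (i : Λ) : Grassmann Λ := 1 - xi i * eta i

/-- `1 / z_i = 1 + ξ_i η_i`. -/
def zInv (i : Λ) : Grassmann Λ := 1 + xi i * eta i

/-- The inner product `u_i · u_j = - ξ_i η_j - ξ_j η_i - z_i z_j`. -/
def dot (i j : Λ) : Grassmann Λ := -(xi i * eta j) - xi j * eta i - z i * z j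

/-- `(u_i - u_j)² = u_i · u_i + u_j · u_j - 2 u_i · u_j`. -/
def sqDist (i j : Λ) : Grassmann Λ := dot i i + dot j j - (2 : ℝ) • dot i j

theorem xi_mul_eta_commute (i j : Λ) (x : Grassmann Λ) : Commute (xi i * eta j) x :=
  even_commute _ _ x

theorem xi_mul_eta_sq (i j : Λ) : (xi i * eta j) * (xi i * eta j) = 0 := by
  rw [mul_assoc, ← mul_assoc (eta j), ← neg_eq_zero]
  have : eta j * xi i = -(xi i * eta j) :=
    eq_neg_of_add_eq_zero_left (ExteriorAlgebra.ι_add_mul_swap _ _)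
  rw [this]
  have h2 : eta j * eta j = (0 : Grassmann Λ) := ExteriorAlgebra.ι_sq_zero _
  simp [mul_assoc, h2]

theorem z_mul_zInv (i : Λ) : z i * zInv i = 1 := by
  simp only [z, zInv, sub_mul, mul_add, one_mul, mul_one, xi_mul_eta_sq]
  abel

/-- `z_i` is the square root of `1 - 2 ξ_i η_i`. -/
theorem z_mul_z (i : Λ) : z i * z i = 1 - (2 : ℝ) • (xi i * eta i) := by
  simp only [z, sub_mul, mul_sub, one_mul, mul_one, xi_mul_eta_sq, two_smul]
  abel

/-- The integral over the spin at `i`: the operator `F ↦ ∂_{η_i} ∂_{ξ_i} ((1 / z_i) F)`. -/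
def siteIntegral (i : Λ) : Module.End ℝ (Grassmann Λ) :=
  dEta i * dXi i * LinearMap.mulLeft ℝ (zInv i)

theorem siteIntegral_commute {i j : Λ} (hij : i ≠ j) :
    Commute (siteIntegral i) (siteIntegral j) := by
  have key : ∀ {i j : Λ}, i ≠ j →
      Commute (dEta i * dXi i) (LinearMap.mulLeft ℝ (zInv j)) := by
    intro i j hij
    refine LinearMap.ext fun F => ?_
    simp only [Module.End.mul_apply, LinearMap.mulLeft_apply, zInv, add_mul, one_mul, map_add]
    congr 1
    have hx : dXi i (xi j * eta j * F) = xi j * eta j * dXi i F :=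
      contractLeft_mul_even _ _ _ (by simp [hij]) (by simp) F
    have he : ∀ G, dEta i (xi j * eta j * G) = xi j * eta j * dEta i G := fun G =>
      contractLeft_mul_even _ _ _ (by simp) (by simp [hij]) G
    rw [hx, he]
  have pp : Commute (dEta i * dXi i) (dEta j * dXi j) := by
    refine LinearMap.ext fun F => ?_
    simp only [Module.End.mul_apply]
    unfold dEta dXi
    rw [dual_commute (LinearMap.proj (Sum.inl i)) (LinearMap.proj (Sum.inr j)), map_neg,
      dual_commute (LinearMap.proj (Sum.inr i)) (LinearMap.proj (Sum.inr j)), neg_neg,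
      dual_commute (LinearMap.proj (Sum.inl i)) (LinearMap.proj (Sum.inl j)), map_neg, map_neg,
      dual_commute (LinearMap.proj (Sum.inr i)) (LinearMap.proj (Sum.inl j)), map_neg, neg_neg]
  have mm : Commute (LinearMap.mulLeft ℝ (zInv i)) (LinearMap.mulLeft ℝ (zInv j)) := by
    refine LinearMap.ext fun F => ?_
    simp only [Module.End.mul_apply, LinearMap.mulLeft_apply, ← mul_assoc]
    congr 1
    exact (Commute.one_left _).add_left (xi_mul_eta_commute i i _)
  exact (pp.mul_right (key hij)).mul_left ((key hij.symm).symm.mul_right mm)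

variable [Fintype Λ]

/-- The hyperbolic fermionic integral `[F]_0 = ∏_i (∂_{η_i} ∂_{ξ_i} (1 / z_i)) F`. The result lies
in the scalars `ℝ`, and `algebraMapInv` reads it off. -/
def integral (F : Grassmann Λ) : ℝ :=
  ExteriorAlgebra.algebraMapInv
    (Finset.univ.noncommProd (fun i : Λ => siteIntegral i)
      (fun _ _ _ _ hij => siteIntegral_commute hij) F)

/-- The action
`H_{β,h} = ¼ ∑_{i,j} β_{ij} (u_i - u_j)² + ∑_i h_i (z_i - 1)`. -/
def action (β : Sym2 Λ → ℝ) (h : Λ → ℝ) : Grassmann Λ :=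
  (1 / 4 : ℝ) • (∑ i, ∑ j, β s(i, j) • sqDist i j) + ∑ i, h i • (z i - 1)

/-- The action is nilpotent, so that its exponential is a finite sum. -/
theorem action_isNilpotent (β : Sym2 Λ → ℝ) (h : Λ → ℝ) : IsNilpotent (action β h) := by
  let N : Submodule ℝ (Grassmann Λ) :=
    { carrier := {x | IsNilpotent x ∧ ∀ y, Commute x y}
      add_mem' := fun hx hy =>
        ⟨(hx.2 _).isNilpotent_add hx.1 hy.1, fun w => (hx.2 w).add_left (hy.2 w)⟩
      zero_mem' := ⟨IsNilpotent.zero, fun w => Commute.zero_left w⟩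
      smul_mem' := fun c _ hx => ⟨hx.1.smul c, fun w => (hx.2 w).smul_left c⟩ }
  have hp : ∀ i j : Λ, xi i * eta j ∈ N := fun i j =>
    ⟨⟨2, by rw [pow_two, xi_mul_eta_sq]⟩, xi_mul_eta_commute i j⟩
  have hpp : ∀ i j : Λ, (xi i * eta i) * (xi j * eta j) ∈ N := fun i j =>
    ⟨(xi_mul_eta_commute i i _).isNilpotent_mul_right (hp i i).1,
      fun w => (xi_mul_eta_commute i i w).mul_left (xi_mul_eta_commute j j w)⟩
  have hd : ∀ i j : Λ, dot i j + 1 ∈ N := by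
    intro i j
    have : dot i j + 1 = -(xi i * eta j) - xi j * eta i + xi i * eta i + xi j * eta j
        - (xi i * eta i) * (xi j * eta j) := by
      simp only [dot, z, sub_mul, mul_sub, one_mul, mul_one]
      abel
    rw [this]
    exact N.sub_mem (N.add_mem (N.add_mem (N.sub_mem (N.neg_mem (hp i j)) (hp j i)) (hp i i))
      (hp j j)) (hpp i j)
  have hs : ∀ i j : Λ, sqDist i j ∈ N := by
    intro i j
    have : sqDist i j = (dot i i + 1) + (dot j j + 1) - (2 : ℝ) • (dot i j + 1) := by
      simp only [sqDist, two_smul]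
      abel
    rw [this]
    exact N.sub_mem (N.add_mem (hd i i) (hd j j)) (N.smul_mem _ (hd i j))
  have hz : ∀ i : Λ, z i - 1 ∈ N := by
    intro i
    have : z i - 1 = -(xi i * eta i) := by simp only [z]; abel
    rw [this]
    exact N.neg_mem (hp i i)
  exact (N.add_mem (N.smul_mem _ (N.sum_mem fun i _ => N.sum_mem fun j _ => N.smul_mem _ (hs i j)))
    (N.sum_mem fun i _ => N.smul_mem _ (hz i)) : action β h ∈ N).1

/-- The unnormalised expectation `[F]_{β,h} = [F e^{-H_{β,h}}]_0`. -/
def unnormalisedExpectation (β : Sym2 Λ → ℝ) (h : Λ → ℝ) (F : Grassmann Λ) : ℝ :=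
  integral (F * IsNilpotent.exp (-action β h))

/-- The normalised expectation `⟨F⟩_{β,h} = [F]_{β,h} / [1]_{β,h}`. -/
def expectation (β : Sym2 Λ → ℝ) (h : Λ → ℝ) (F : Grassmann Λ) : ℝ :=
  unnormalisedExpectation β h F / unnormalisedExpectation β h 1

end SigmaModel

/-! ### The discrete torus -/

section Torus

/-- The `d`-dimensional discrete torus `(ℤ/Lℤ)^d` of side length `L`. -/
abbrev Torus (d L : ℕ) : Type := Fin d → ZMod L

variable {d L : ℕ}

/-- The coordinates in `{0, …, L - 1}` of a point of the torus, as a vector in `ℝ^d`. -/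
def coords (j : Torus d L) : Fin d → ℝ := fun a => ((j a).val : ℝ)

variable [NeZero L]

/-- The Fourier dual `Λ* = {(2π / L) k : k ∈ {0, …, L - 1}^d}` of the torus, with momenta taken in
`[0, 2π)^d`. -/
def dualTorus (d L : ℕ) [NeZero L] : Finset (Fin d → ℝ) :=
  Finset.univ.image fun k : Torus d L => (2 * Real.pi / L) • coords k

/-- The Fourier multiplier `λ(p) = ∑_j β_{0j} (1 - cos (p · j))` of the Laplacian. -/
def fourierMultiplier (β : Sym2 (Torus d L) → ℝ) (p : Fin d → ℝ) : ℝ :=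
  ∑ j : Torus d L, β s(0, j) * (1 - Real.cos (p ⬝ᵥ coords j))

end Torus

end ArborealGas

end

noncomputable section

namespace ArborealGas

set_option linter.unusedSectionVars false

section Generators

variable {Λ : Type*} [DecidableEq Λ]

/-! ### Generators and odd derivations -/

/-! Forests. The action is a sum of square-zero even elements, so `e^{-H}` equals `∏_e (1 + β_e f_e)
∏_i (1 + h_i ξ_i η_i)`, where `f_e` is the bond element. A bond acts as a delta function:
`bond_mul_subst` identifies the spins at its ends, and integrating out one end gives 1. Hence a set
of bonds containing a cycle integrates to zero, and an acyclic set gives a factor `1 + ∑_{i ∈ T}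
h_i` for each tree (`gint_prod_edgeBond`, `gint_forest`). Inserting `ξ_x η_x` raises `h_x` by one,
so `⟨z_x⟩ = 1 - D/Z` with `D = Z(h + δ_x) - Z(h)`. Since `D` counts each forest with the factor of
the tree of `x` replaced by 1, this is the first claim.

Rooting. Expanding the tree factors declares each tree unrooted (factor 1) or rooted (factor `∑
h_i`). With `C` the union of the rooted trees, `Z = ∑_C Φ(C)` where `Φ(C) ≥ 0`
(`sum_splitPartition`). So `C` is a random set, and `P(x ∈ C) = 1 - D/Z = ⟨z_x⟩`. Rooted trees have
mass 0, which makes the model inside `C` a free fermion: integration by parts (`splitGreen_eq`)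
shows that its two-point function is `Φ(C) G_C`, with `G_C` the Green function of the Laplacian on
`C` killed at rate `h`. Differencing `Z = ∑_C Φ(C)` in `h_x` then gives `1 - ⟨z_x⟩ = E[1_{x ∈ C}
G_C(x,x)]`.

Comparison. By the Dirichlet principle, `G_C(x,x) ≥ 2 w(x) - E_C(w,w)` for every test function `w`.
Since `P(i, j ∈ C) ≤ P(i ∈ C)`, which by translation invariance does not depend on `i`, averaging
yields `⟨z⟩ (2 w(0) - E_Λ(w,w)) ≤ 1 - ⟨z⟩` (`partitionFunction_dirichlet_le`). For `w` the torus
Green function the bracket is `w(0) = L^{-d} ∑_p 1/(λ(p) + h)`. This is the second claim without the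
factor `(2π)^{-d}`, which is only given away. -/

theorem xi_mul_xi (i j : Λ) : xi i * xi j = -(xi j * xi i) :=
  eq_neg_of_add_eq_zero_left (ExteriorAlgebra.ι_add_mul_swap _ _)

theorem eta_mul_eta (i j : Λ) : eta i * eta j = -(eta j * eta i) :=
  eq_neg_of_add_eq_zero_left (ExteriorAlgebra.ι_add_mul_swap _ _)

theorem eta_mul_xi (i j : Λ) : eta i * xi j = -(xi j * eta i) :=
  eq_neg_of_add_eq_zero_left (ExteriorAlgebra.ι_add_mul_swap _ _)

theorem dXi_xi_mul (i j : Λ) (F : Grassmann Λ) :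
    dXi i (xi j * F) = (if j = i then F else 0) - xi j * dXi i F := by
  refine (CliffordAlgebra.contractLeft_ι_mul (Q := (0 : QuadraticForm ℝ (Λ ⊕ Λ → ℝ)))
    (LinearMap.proj (Sum.inl i)) (Pi.single (Sum.inl j) 1) F).trans ?_
  congr 1
  by_cases h : j = i
  · simp [h]
  · simp [h, Ne.symm h]

theorem dXi_eta_mul (i j : Λ) (F : Grassmann Λ) :
    dXi i (eta j * F) = -(eta j * dXi i F) := by
  refine (CliffordAlgebra.contractLeft_ι_mul (Q := (0 : QuadraticForm ℝ (Λ ⊕ Λ → ℝ)))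
    (LinearMap.proj (Sum.inl i)) (Pi.single (Sum.inr j) 1) F).trans ?_
  simp only [LinearMap.proj_apply, Pi.single_apply, reduceCtorEq, if_false, zero_smul, zero_sub]
  rfl

theorem dEta_eta_mul (i j : Λ) (F : Grassmann Λ) :
    dEta i (eta j * F) = (if j = i then F else 0) - eta j * dEta i F := by
  refine (CliffordAlgebra.contractLeft_ι_mul (Q := (0 : QuadraticForm ℝ (Λ ⊕ Λ → ℝ)))
    (LinearMap.proj (Sum.inr i)) (Pi.single (Sum.inr j) 1) F).trans ?_
  congr 1
  by_cases h : j = i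
  · simp [h]
  · simp [h, Ne.symm h]

theorem dEta_xi_mul (i j : Λ) (F : Grassmann Λ) :
    dEta i (xi j * F) = -(xi j * dEta i F) := by
  refine (CliffordAlgebra.contractLeft_ι_mul (Q := (0 : QuadraticForm ℝ (Λ ⊕ Λ → ℝ)))
    (LinearMap.proj (Sum.inr i)) (Pi.single (Sum.inl j) 1) F).trans ?_
  simp only [LinearMap.proj_apply, Pi.single_apply, reduceCtorEq, if_false, zero_smul, zero_sub]
  rfl

theorem dXi_algebraMap (i : Λ) (r : ℝ) : dXi i (algebraMap ℝ (Grassmann Λ) r) = 0 :=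
  CliffordAlgebra.contractLeft_algebraMap (Q := (0 : QuadraticForm ℝ (Λ ⊕ Λ → ℝ))) _ _

theorem dEta_algebraMap (i : Λ) (r : ℝ) : dEta i (algebraMap ℝ (Grassmann Λ) r) = 0 :=
  CliffordAlgebra.contractLeft_algebraMap (Q := (0 : QuadraticForm ℝ (Λ ⊕ Λ → ℝ))) _ _

theorem dXi_dEta (i j : Λ) (F : Grassmann Λ) : dXi i (dEta j F) = -dEta j (dXi i F) :=
  dual_commute _ _ F

theorem dXi_dXi (i j : Λ) (F : Grassmann Λ) : dXi i (dXi j F) = -dXi j (dXi i F) :=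
  dual_commute _ _ F

theorem dEta_dEta (i j : Λ) (F : Grassmann Λ) : dEta i (dEta j F) = -dEta j (dEta i F) :=
  dual_commute _ _ F

theorem dEta_dEta_self (i : Λ) (F : Grassmann Λ) : dEta i (dEta i F) = 0 :=
  CliffordAlgebra.contractLeft_contractLeft _ F

/-! ### Even elements -/

/-- The (commutative) centre of the Grassmann algebra, which contains its even elements. -/
def GrassmannCenter (Λ : Type*) : Type _ := Subring.center (Grassmann Λ)

/-- Only even elements occur in the Boltzmann weight. In a commutative ring they can be multiplied
over edges and sites without regard to order, and `ring` applies to them. -/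
instance : CommRing (GrassmannCenter Λ) :=
  inferInstanceAs (CommRing (Subring.center (Grassmann Λ)))

/-- The inclusion of the centre into the Grassmann algebra. -/
def centerVal : GrassmannCenter Λ →+* Grassmann Λ := (Subring.center (Grassmann Λ)).subtype

instance : Algebra ℝ (GrassmannCenter Λ) :=
  RingHom.toAlgebra ((algebraMap ℝ (Grassmann Λ)).codRestrict (Subring.center (Grassmann Λ))
    fun r => Subring.mem_center_iff.2 fun x => (Algebra.commutes r x).symm)

theorem centerVal_injective : Function.Injective (centerVal (Λ := Λ)) := Subtype.val_injective

theorem centerVal_commute (x : GrassmannCenter Λ) (y : Grassmann Λ) :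
    centerVal x * y = y * centerVal x :=
  (Subring.mem_center_iff.1 x.2 y).symm

theorem centerVal_algebraMap (c : ℝ) :
    centerVal (algebraMap ℝ (GrassmannCenter Λ) c) = algebraMap ℝ (Grassmann Λ) c := rfl

theorem centerVal_smul (c : ℝ) (x : GrassmannCenter Λ) :
    centerVal (c • x) = c • centerVal x := by
  rw [Algebra.smul_def, map_mul, centerVal_algebraMap, Algebra.smul_def]

/-- The element `ξ_i η_j` of the centre of the Grassmann algebra. -/
def pair (i j : Λ) : GrassmannCenter Λ :=
  ⟨xi i * eta j, Subring.mem_center_iff.2 fun x => (xi_mul_eta_commute i j x).symm⟩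

theorem centerVal_pair (i j : Λ) : centerVal (pair i j) = xi i * eta j := rfl

theorem pair_mul_pair_self (i j : Λ) : pair i j * pair i j = 0 :=
  Subtype.ext (xi_mul_eta_sq i j)

theorem pair_mul_xi (i j k : Λ) :
    centerVal (pair i k) * xi j = -(centerVal (pair j k) * xi i) := by
  simp only [centerVal_pair, mul_assoc, eta_mul_xi]
  simp only [mul_neg, ← mul_assoc]
  rw [xi_mul_xi i j, neg_mul]

theorem pair_mul_eta (i j k : Λ) :
    centerVal (pair k i) * eta j = -(centerVal (pair k j) * eta i) := by
  simp only [centerVal_pair, mul_assoc]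
  rw [eta_mul_eta i j, mul_neg]

theorem grassmann_eq_zero_of_eq_neg {x : Grassmann Λ} (h : x = -x) : x = 0 := by
  have h2 : (2 : ℝ) • x = 0 := by
    rw [two_smul]
    nth_rewrite 1 [h]
    exact neg_add_cancel x
  exact (smul_eq_zero.1 h2).resolve_left two_ne_zero

theorem pair_mul_xi_self (i k : Λ) : centerVal (pair i k) * xi i = 0 :=
  grassmann_eq_zero_of_eq_neg (pair_mul_xi i i k)

theorem pair_mul_eta_self (i k : Λ) : centerVal (pair k i) * eta i = 0 :=
  grassmann_eq_zero_of_eq_neg (pair_mul_eta i i k)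

/-- The bond element `(ξ_i - ξ_j)(η_i - η_j) - c ξ_i η_i ξ_j η_j`. -/
def bond (c : ℝ) (i j : Λ) : GrassmannCenter Λ :=
  pair i i + pair j j - pair i j - pair j i - c • (pair i i * pair j j)

theorem bond_swap (c : ℝ) (i j : Λ) : bond c i j = bond c j i := by
  unfold bond
  rw [mul_comm (pair i i)]
  ring

theorem bond_self (c : ℝ) (i : Λ) : bond c i i = 0 := by
  unfold bond
  rw [pair_mul_pair_self, smul_zero]
  ring

theorem centerVal_bond_mul (c : ℝ) (i j : Λ) (x : Grassmann Λ) :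
    centerVal (bond c i j) * x = centerVal (pair i i) * x
      + centerVal (pair j j) * x - centerVal (pair i j) * x - centerVal (pair j i) * x
      - c • (centerVal (pair i i) * (centerVal (pair j j) * x)) := by
  simp only [bond, map_sub, map_add, centerVal_smul, map_mul, sub_mul, add_mul, smul_mul_assoc,
    mul_assoc]

/-- The quadratic part of the bond has the factor `ξ_i - ξ_j`, which squares to zero, and the
quartic part is killed by both `ξ_i` and `ξ_j`. -/
theorem bond_mul_xi (c : ℝ) (i j : Λ) :
    centerVal (bond c i j) * xi i = centerVal (bond c i j) * xi j := by
  rw [centerVal_bond_mul, centerVal_bond_mul, pair_mul_xi_self i i, pair_mul_xi_self i j,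
    pair_mul_xi_self j i, pair_mul_xi_self j j, ← mul_assoc _ _ (xi i),
    centerVal_commute (pair i i), mul_assoc, pair_mul_xi_self i i,
    pair_mul_xi j i j, pair_mul_xi j i i]
  simp only [mul_zero, smul_zero]
  abel

theorem bond_mul_eta (c : ℝ) (i j : Λ) :
    centerVal (bond c i j) * eta i = centerVal (bond c i j) * eta j := by
  rw [centerVal_bond_mul, centerVal_bond_mul, pair_mul_eta_self i i, pair_mul_eta_self i j,
    pair_mul_eta_self j i, pair_mul_eta_self j j, ← mul_assoc _ _ (eta i),
    centerVal_commute (pair i i), mul_assoc, pair_mul_eta_self i i,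
    pair_mul_eta j i j, pair_mul_eta j i i]
  simp only [mul_zero, smul_zero]
  abel

theorem bond_mul_pair_left (c : ℝ) (i j k : Λ) :
    bond c i j * pair i k = bond c i j * pair j k := by
  refine centerVal_injective ?_
  simp only [map_mul, centerVal_pair, ← mul_assoc]
  rw [bond_mul_xi]

theorem bond_mul_pair_right (c : ℝ) (i j k : Λ) :
    bond c i j * pair k i = bond c i j * pair k j := by
  refine centerVal_injective ?_
  simp only [map_mul, centerVal_pair, ← mul_assoc]
  rw [centerVal_commute, mul_assoc, bond_mul_eta, ← mul_assoc]

/-- Next to one bond, the index `i` in the second may be replaced by `j`: its quadratic terms then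
cancel, and its quartic term becomes `(ξ_j η_j)² = 0`. -/
theorem bond_mul_self (c : ℝ) (i j : Λ) : bond c i j * bond c i j = 0 := by
  have hr : bond c i j * (pair i i * pair j j) = 0 := by
    rw [mul_left_comm, ← bond_mul_pair_left, ← bond_mul_pair_right, mul_left_comm,
      pair_mul_pair_self, mul_zero]
  conv_lhs => arg 2; unfold bond
  rw [mul_sub, mul_sub, mul_sub, mul_add, mul_smul_comm, hr, smul_zero, bond_mul_pair_left,
    bond_mul_pair_left c i j j]
  ring

/-! ### Substitutions -/

section Subst

variable [Fintype Λ]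

/-- The substitution `ξ_i ↦ ξ_{r i}`, `η_i ↦ η_{r i}`. -/
def subst (r : Λ → Λ) : Grassmann Λ →ₐ[ℝ] Grassmann Λ :=
  ExteriorAlgebra.map ((Pi.basisFun ℝ (Λ ⊕ Λ)).constr ℝ
    fun s => (Pi.single (Sum.map r r s) 1 : Λ ⊕ Λ → ℝ))

theorem subst_xi (r : Λ → Λ) (i : Λ) : subst r (xi i) = xi (r i) := by
  have := (Pi.basisFun ℝ (Λ ⊕ Λ)).constr_basis ℝ
    (fun s => (Pi.single (Sum.map r r s) 1 : Λ ⊕ Λ → ℝ)) (Sum.inl i)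
  rw [Pi.basisFun_apply] at this
  rw [subst, xi, ExteriorAlgebra.map_apply_ι, this]
  rfl

theorem subst_eta (r : Λ → Λ) (i : Λ) : subst r (eta i) = eta (r i) := by
  have := (Pi.basisFun ℝ (Λ ⊕ Λ)).constr_basis ℝ
    (fun s => (Pi.single (Sum.map r r s) 1 : Λ ⊕ Λ → ℝ)) (Sum.inr i)
  rw [Pi.basisFun_apply] at this
  rw [subst, eta, ExteriorAlgebra.map_apply_ι, this]
  rfl

/-- Induction on elements of the Grassmann algebra, multiplying by generators from the left. -/
theorem grassmann_induction {P : Grassmann Λ → Prop} (halg : ∀ r : ℝ, P (algebraMap ℝ _ r))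
    (hadd : ∀ x y, P x → P y → P (x + y)) (hsmul : ∀ (c : ℝ) x, P x → P (c • x))
    (hxi : ∀ i x, P x → P (xi i * x)) (heta : ∀ i x, P x → P (eta i * x)) (x : Grassmann Λ) :
    P x := by
  refine CliffordAlgebra.left_induction (Q := (0 : QuadraticForm ℝ (Λ ⊕ Λ → ℝ))) halg
    (fun x y => hadd x y) (fun x m hx => ?_) x
  have hm : m = ∑ s, m s • (Pi.single s 1 : Λ ⊕ Λ → ℝ) := by
    ext t
    simp [Finset.sum_apply, Pi.single_apply]
  have hP0 : P 0 := by simpa using halg 0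
  have key : ∀ u : Finset (Λ ⊕ Λ),
      P (∑ s ∈ u, m s • (ExteriorAlgebra.ι ℝ (Pi.single s 1 : Λ ⊕ Λ → ℝ) * x)) := by
    intro u
    induction u using Finset.induction_on with
    | empty => simpa using hP0
    | insert s u hs ih =>
      rw [Finset.sum_insert hs]
      refine hadd _ _ (hsmul _ _ ?_) ih
      rcases s with i | i
      · exact hxi i x hx
      · exact heta i x hx
  have e : CliffordAlgebra.ι (0 : QuadraticForm ℝ (Λ ⊕ Λ → ℝ)) m * x
      = ∑ s, m s • (ExteriorAlgebra.ι ℝ (Pi.single s 1 : Λ ⊕ Λ → ℝ) * x) := by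
    conv_lhs => rw [hm]
    simp only [map_sum, map_smul, Finset.sum_mul, smul_mul_assoc]
  rw [e]
  exact key _

theorem subst_subst (r s : Λ → Λ) (x : Grassmann Λ) : subst s (subst r x) = subst (s ∘ r) x := by
  induction x using grassmann_induction with
  | halg c => simp
  | hadd x y hx hy => simp [hx, hy]
  | hsmul c x hx => simp [hx]
  | hxi i x hx => simp [hx, subst_xi]
  | heta i x hx => simp [hx, subst_eta]

theorem subst_id (x : Grassmann Λ) : subst id x = x := by
  induction x using grassmann_induction with
  | halg c => simp
  | hadd x y hx hy => simp [hx, hy]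
  | hsmul c x hx => simp [hx]
  | hxi i x hx => simp [hx, subst_xi]
  | heta i x hx => simp [hx, subst_eta]

theorem subst_pair (r : Λ → Λ) (i j : Λ) :
    subst r (centerVal (pair i j)) = centerVal (pair (r i) (r j)) := by
  simp [centerVal_pair, subst_xi, subst_eta]

theorem subst_bond (r : Λ → Λ) (c : ℝ) (i j : Λ) :
    subst r (centerVal (bond c i j)) = centerVal (bond c (r i) (r j)) := by
  simp only [bond, map_sub, map_add, map_mul, map_smul, centerVal_smul, subst_pair]

theorem dXi_subst {r : Λ → Λ} {a : Λ} (ha : ∀ i, r i ≠ a) (x : Grassmann Λ) :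
    dXi a (subst r x) = 0 := by
  induction x using grassmann_induction with
  | halg c => rw [AlgHom.commutes]; exact dXi_algebraMap _ _
  | hadd x y hx hy => simp [hx, hy]
  | hsmul c x hx => simp [hx]
  | hxi i x hx => rw [map_mul, subst_xi, dXi_xi_mul, hx, if_neg (ha i)]; simp
  | heta i x hx => rw [map_mul, subst_eta, dXi_eta_mul, hx]; simp

theorem dEta_subst {r : Λ → Λ} {a : Λ} (ha : ∀ i, r i ≠ a) (x : Grassmann Λ) :
    dEta a (subst r x) = 0 := by
  induction x using grassmann_induction with
  | halg c => rw [AlgHom.commutes]; exact dEta_algebraMap _ _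
  | hadd x y hx hy => simp [hx, hy]
  | hsmul c x hx => simp [hx]
  | hxi i x hx => rw [map_mul, subst_xi, dEta_xi_mul, hx]; simp
  | heta i x hx => rw [map_mul, subst_eta, dEta_eta_mul, hx, if_neg (ha i)]; simp

/-- The bond element between `a` and `b` identifies the spins at `a` and `b`. -/
theorem bond_mul_subst (c : ℝ) (a b : Λ) (x : Grassmann Λ) :
    centerVal (bond c a b) * x
      = centerVal (bond c a b) * subst (Function.update id a b) x := by
  have hk : ∀ i : Λ, centerVal (bond c a b) * xi i
      = centerVal (bond c a b) * xi (Function.update id a b i) := by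
    intro i
    by_cases hi : i = a
    · subst hi; simpa using bond_mul_xi c i b
    · simp [hi]
  have hl : ∀ i : Λ, centerVal (bond c a b) * eta i
      = centerVal (bond c a b) * eta (Function.update id a b i) := by
    intro i
    by_cases hi : i = a
    · subst hi; simpa using bond_mul_eta c i b
    · simp [hi]
  have step : ∀ u v x y : Grassmann Λ, centerVal (bond c a b) * u = centerVal (bond c a b) * v →
      centerVal (bond c a b) * x = centerVal (bond c a b) * y →
      centerVal (bond c a b) * (u * x) = centerVal (bond c a b) * (v * y) := by
    intro u v x y hu hx
    rw [← mul_assoc, centerVal_commute, mul_assoc, hx, ← mul_assoc, ← centerVal_commute, hu,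
      mul_assoc]
  induction x using grassmann_induction with
  | halg c => simp
  | hadd x y hx hy => simp [mul_add, hx, hy]
  | hsmul c x hx => simp [hx]
  | hxi i x hx =>
    rw [map_mul, subst_xi]
    exact step _ _ _ _ (hk i) hx
  | heta i x hx =>
    rw [map_mul, subst_eta]
    exact step _ _ _ _ (hl i) hx

end Subst

end Generators

section Sites

/-! ### Graphs with a given set of edges -/

section EdgeGraph

variable {Λ : Type*}

theorem eq_of_reachable {V α : Type*} {G : SimpleGraph V} {f : V → α}
    (hf : ∀ x y, G.Adj x y → f x = f y) {x y : V} (h : G.Reachable x y) : f x = f y := by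
  obtain ⟨p⟩ := h
  induction p with
  | nil => rfl
  | cons hadj _ ih => exact (hf _ _ hadj).trans ih

/-- The graph with a given set of edges. -/
def edgeGraph (S : Finset (Sym2 Λ)) : SimpleGraph Λ := SimpleGraph.fromEdgeSet (S : Set (Sym2 Λ))

theorem edgeGraph_adj {S : Finset (Sym2 Λ)} {i j : Λ} :
    (edgeGraph S).Adj i j ↔ s(i, j) ∈ S ∧ i ≠ j := SimpleGraph.fromEdgeSet_adj _

end EdgeGraph

variable {Λ : Type*} [DecidableEq Λ]

/-! ### Site operators with general single-site weights -/

theorem dXi_pair_mul (i j k : Λ) (F : Grassmann Λ) :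
    dXi i (centerVal (pair j k) * F)
      = (if j = i then eta k * F else 0) + centerVal (pair j k) * dXi i F := by
  rw [centerVal_pair, mul_assoc, dXi_xi_mul, dXi_eta_mul, mul_neg, sub_neg_eq_add, mul_assoc]

theorem dEta_pair_mul (i j k : Λ) (F : Grassmann Λ) :
    dEta i (centerVal (pair j k) * F)
      = -(if k = i then xi j * F else 0) + centerVal (pair j k) * dEta i F := by
  rw [centerVal_pair, mul_assoc, dEta_xi_mul, dEta_eta_mul, mul_sub, neg_sub, mul_assoc,
    mul_ite, mul_zero]
  abel

/-- The single-site weight `c + μ ξ_i η_i`. -/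
def siteElt (c μ : ℝ) (i : Λ) : GrassmannCenter Λ := algebraMap ℝ _ c + μ • pair i i

theorem centerVal_siteElt_mul (c μ : ℝ) (i : Λ) (F : Grassmann Λ) :
    centerVal (siteElt c μ i) * F = c • F + μ • (centerVal (pair i i) * F) := by
  rw [siteElt, map_add, add_mul, centerVal_smul, smul_mul_assoc, centerVal_algebraMap,
    ← Algebra.smul_def]

theorem siteElt_mul_siteElt (c μ h : ℝ) (i : Λ) :
    siteElt c μ i * siteElt 1 h i = siteElt c (μ + c * h) i := by
  simp only [siteElt, map_one, mul_add, add_mul, mul_one, smul_mul_smul_comm, pair_mul_pair_self,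
    smul_zero, add_zero, ← Algebra.smul_def, smul_smul, add_smul, add_assoc]

theorem siteElt_one_mul_add (h h' : ℝ) (i : Λ) :
    siteElt 1 h i * siteElt 1 h' i = siteElt 1 (h + h') i := by
  rw [siteElt_mul_siteElt, one_mul]

theorem dXi_siteElt_mul {i j : Λ} (hij : j ≠ i) (c μ : ℝ) (F : Grassmann Λ) :
    dXi i (centerVal (siteElt c μ j) * F) = centerVal (siteElt c μ j) * dXi i F := by
  rw [centerVal_siteElt_mul, centerVal_siteElt_mul, map_add, map_smul, map_smul, dXi_pair_mul,
    if_neg hij, zero_add]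

theorem dEta_siteElt_mul {i j : Λ} (hij : j ≠ i) (c μ : ℝ) (F : Grassmann Λ) :
    dEta i (centerVal (siteElt c μ j) * F) = centerVal (siteElt c μ j) * dEta i F := by
  rw [centerVal_siteElt_mul, centerVal_siteElt_mul, map_add, map_smul, map_smul, dEta_pair_mul,
    if_neg hij, neg_zero, zero_add]

/-- The operator `F ↦ ∂_{η_i} ∂_{ξ_i} ((c + μ ξ_i η_i) F)`. -/
def siteOp (c μ : ℝ) (i : Λ) : Module.End ℝ (Grassmann Λ) :=
  dEta i * dXi i * LinearMap.mulLeft ℝ (centerVal (siteElt c μ i))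

theorem siteOp_apply (c μ : ℝ) (i : Λ) (F : Grassmann Λ) :
    siteOp c μ i F = dEta i (dXi i (centerVal (siteElt c μ i) * F)) := rfl

theorem siteOp_commute (c μ c' μ' : ℝ) {i j : Λ} (hij : i ≠ j) :
    Commute (siteOp c μ i) (siteOp c' μ' j) := by
  refine LinearMap.ext fun F => ?_
  simp only [Module.End.mul_apply, siteOp_apply]
  rw [← dEta_siteElt_mul hij, ← dEta_siteElt_mul hij.symm, ← dXi_siteElt_mul hij,
    ← dXi_siteElt_mul hij.symm, ← mul_assoc, ← mul_assoc,
    centerVal_commute (siteElt c' μ' j) (centerVal (siteElt c μ i))]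
  generalize centerVal (siteElt c μ i) * centerVal (siteElt c' μ' j) * F = G
  rw [dXi_dEta, map_neg, dEta_dEta, dXi_dXi, map_neg, map_neg, dXi_dEta j i, map_neg,
    neg_neg]

theorem siteOp_of_indep {a : Λ} {Y : Grassmann Λ} (hx : dXi a Y = 0) (he : dEta a Y = 0)
    (c μ : ℝ) : siteOp c μ a Y = μ • Y := by
  rw [siteOp_apply, centerVal_siteElt_mul, map_add, map_smul, map_smul, hx, smul_zero, zero_add,
    dXi_pair_mul, hx, if_pos rfl, mul_zero, add_zero, map_smul, dEta_eta_mul, he, if_pos rfl,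
    mul_zero, sub_zero]

/-- The quartic term of the bond is there to be cancelled by the site weight, which leaves exactly
`(ξ_a - ξ_b)(η_a - η_b)`. For this the constant of the bond must equal the mass of the site. -/
theorem siteElt_mul_bond {μ : ℝ} (a b : Λ) :
    siteElt 1 μ a * bond μ a b = pair a a + pair b b - pair a b - pair b a := by
  have h1 : pair a a * pair a b = 0 := by
    refine centerVal_injective ?_
    rw [map_mul, centerVal_pair a b, ← mul_assoc, pair_mul_xi_self, zero_mul, map_zero]
  have h2 : pair a a * pair b a = 0 := by
    refine centerVal_injective ?_
    rw [map_mul, centerVal_commute, centerVal_pair a a, ← mul_assoc, centerVal_pair b a,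
      mul_assoc (xi b), eta_mul_xi, mul_neg, neg_mul, ← mul_assoc, mul_assoc _ (eta a) (eta a),
      grassmann_eq_zero_of_eq_neg (eta_mul_eta a a), mul_zero, neg_zero, map_zero]
  simp only [siteElt, map_one, bond, add_mul, one_mul, smul_mul_assoc, mul_sub, mul_add,
    pair_mul_pair_self, h1, h2, mul_smul_comm]
  rw [← mul_assoc, pair_mul_pair_self]
  simp only [smul_add, smul_zero, zero_mul]
  ring

/-- The bond is a delta function of total mass 1 at the spin `a`. -/
theorem siteOp_bond_mul {a b : Λ} (hab : a ≠ b) {Y : Grassmann Λ} (hx : dXi a Y = 0)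
    (he : dEta a Y = 0) (μ : ℝ) : siteOp 1 μ a (centerVal (bond μ a b) * Y) = Y := by
  rw [siteOp_apply, ← mul_assoc, ← map_mul, siteElt_mul_bond]
  simp only [map_add, map_sub, add_mul, sub_mul, dXi_pair_mul, hx, dEta_eta_mul, he, hab.symm,
    if_true, if_false, mul_zero, add_zero, sub_zero]

theorem siteOp_pairwise_commute (c μ : Λ → ℝ) (s : Set Λ) :
    s.Pairwise (Function.onFun Commute fun i => siteOp (c i) (μ i) i) :=
  fun _ _ _ _ hij => siteOp_commute _ _ _ _ hij

variable [Fintype Λ]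

/-- The Grassmann integral with single-site weights `c_i + μ_i ξ_i η_i`. -/
def gint (c μ : Λ → ℝ) : Grassmann Λ →ₗ[ℝ] ℝ :=
  ExteriorAlgebra.algebraMapInv.toLinearMap ∘ₗ
    Finset.univ.noncommProd (fun i : Λ => siteOp (c i) (μ i) i)
      (siteOp_pairwise_commute c μ _)

theorem gint_apply (c μ : Λ → ℝ) (F : Grassmann Λ) :
    gint c μ F = ExteriorAlgebra.algebraMapInv
      (Finset.univ.noncommProd (fun i : Λ => siteOp (c i) (μ i) i)
        (siteOp_pairwise_commute c μ _) F) := rfl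

theorem siteIntegral_eq (i : Λ) : siteIntegral i = siteOp 1 1 i := by
  rw [siteIntegral, siteOp]
  congr 2
  rw [siteElt, one_smul, map_one, map_add, map_one]
  rfl

theorem integral_eq_gint (F : Grassmann Λ) : integral F = gint (fun _ => 1) (fun _ => 1) F := by
  rw [gint_apply, integral]
  congr 2
  exact Finset.noncommProd_congr rfl (fun i _ => siteIntegral_eq i) _

/-- The site operators commute, so the integral over the spin at `a` can be performed first. -/
theorem gint_congr_of_siteOp {c μ c' μ' : Λ → ℝ} (a : Λ) (hc : ∀ k, k ≠ a → c k = c' k)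
    (hμ : ∀ k, k ≠ a → μ k = μ' k) {F F' : Grassmann Λ}
    (h : siteOp (c a) (μ a) a F = siteOp (c' a) (μ' a) a F') : gint c μ F = gint c' μ' F' := by
  rw [gint_apply, gint_apply, ← Finset.noncommProd_erase_mul _ (Finset.mem_univ a),
    ← Finset.noncommProd_erase_mul _ (Finset.mem_univ a), Module.End.mul_apply,
    Module.End.mul_apply, h]
  congr 2
  refine Finset.noncommProd_congr rfl (fun k hk => ?_) _
  rw [hc k (Finset.ne_of_mem_erase hk), hμ k (Finset.ne_of_mem_erase hk)]

/-- Contracting `a` into `b` keeps `a` as a dummy site: with weight `0 + 1 · ξ_a η_a` it integrates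
anything free of `a` to itself. The vertex set therefore never has to change. -/
theorem gint_bond_mul (c μ : Λ → ℝ) {a b : Λ} (hab : a ≠ b) (hc : c a = 1) (x : Grassmann Λ) :
    gint c μ (centerVal (bond (μ a) a b) * x)
      = gint (Function.update c a 0) (Function.update μ a 1)
          (subst (Function.update id a b) x) := by
  have hne : ∀ i, Function.update id a b i ≠ a := by
    intro i
    by_cases hi : i = a
    · subst hi; simpa using hab.symm
    · simp [hi]
  rw [bond_mul_subst]
  refine gint_congr_of_siteOp a (fun k hk => by simp [hk]) (fun k hk => by simp [hk]) ?_
  rw [hc, siteOp_bond_mul hab (dXi_subst hne x) (dEta_subst hne x), Function.update_self,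
    Function.update_self, siteOp_of_indep (dXi_subst hne x) (dEta_subst hne x), one_smul]

theorem gint_prod_siteElt (c μ h : Λ → ℝ) :
    gint c μ (centerVal (∏ k, siteElt 1 (h k) k)) = ∏ k, (μ k + c k * h k) := by
  have hX : ∀ (a : Λ) (s : Finset Λ), a ∉ s → dXi a (centerVal (∏ k ∈ s, siteElt 1 (h k) k)) = 0 := by
    intro a s
    induction s using Finset.induction_on with
    | empty => intro _; simpa using dXi_algebraMap a 1
    | insert b s hb ih =>
      intro ha
      rw [Finset.mem_insert, not_or] at ha
      rw [Finset.prod_insert hb, map_mul, dXi_siteElt_mul (Ne.symm ha.1), ih ha.2, mul_zero]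
  have hE : ∀ (a : Λ) (s : Finset Λ), a ∉ s →
      dEta a (centerVal (∏ k ∈ s, siteElt 1 (h k) k)) = 0 := by
    intro a s
    induction s using Finset.induction_on with
    | empty => intro _; simpa using dEta_algebraMap a 1
    | insert b s hb ih =>
      intro ha
      rw [Finset.mem_insert, not_or] at ha
      rw [Finset.prod_insert hb, map_mul, dEta_siteElt_mul (Ne.symm ha.1), ih ha.2, mul_zero]
  have key : ∀ s : Finset Λ, s.noncommProd (fun i : Λ => siteOp (c i) (μ i) i)
        (siteOp_pairwise_commute c μ _) (centerVal (∏ k ∈ s, siteElt 1 (h k) k))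
      = algebraMap ℝ _ (∏ k ∈ s, (μ k + c k * h k)) := by
    intro s
    induction s using Finset.induction_on with
    | empty => simp
    | insert a s ha ih =>
      rw [Finset.noncommProd_insert_of_notMem' _ _ _ _ ha, Module.End.mul_apply,
        Finset.prod_insert ha, Finset.prod_insert ha, siteOp_apply,
        map_mul centerVal (siteElt 1 (h a) a), ← mul_assoc, ← map_mul centerVal, siteElt_mul_siteElt,
        ← siteOp_apply, siteOp_of_indep (hX a s ha) (hE a s ha), map_smul, ih,
        map_mul, Algebra.smul_def]
  rw [gint_apply, key, ExteriorAlgebra.algebraMap_leftInverse]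

/-! ### Bonds of a graph -/

/-- The constant in the single-site weight: `0` on `C` and `1` elsewhere. -/
def offMass (C : Finset Λ) (i : Λ) : ℝ := if i ∈ C then 0 else 1

/-- The bond element of an edge. -/
def edgeBond (C : Finset Λ) : Sym2 Λ → GrassmannCenter Λ :=
  Sym2.lift ⟨fun i j => bond (offMass C i * offMass C j) i j, fun i j => by
    dsimp only
    rw [bond_swap, mul_comm]⟩

theorem edgeBond_mk (C : Finset Λ) (i j : Λ) :
    edgeBond C s(i, j) = bond (offMass C i * offMass C j) i j := rfl

open scoped Classical in
/-- The edges that join two different vertices, both in `C` or both outside of `C`. -/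
def splitEdges (C : Finset Λ) : Finset (Sym2 Λ) :=
  Finset.univ.filter fun e => ¬e.IsDiag ∧ ∀ i ∈ e, ∀ j ∈ e, (i ∈ C ↔ j ∈ C)

theorem mem_splitEdges {C : Finset Λ} {e : Sym2 Λ} :
    e ∈ splitEdges C ↔ ¬e.IsDiag ∧ ∀ i ∈ e, ∀ j ∈ e, (i ∈ C ↔ j ∈ C) := by
  simp [splitEdges]

theorem mk_mem_splitEdges {C : Finset Λ} {i j : Λ} :
    s(i, j) ∈ splitEdges C ↔ i ≠ j ∧ (i ∈ C ↔ j ∈ C) := by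
  rw [mem_splitEdges]
  simp only [Sym2.mk_isDiag_iff, Sym2.mem_iff, forall_eq_or_imp, forall_eq]
  tauto

theorem mem_iff_of_reachable {C : Finset Λ} {S : Finset (Sym2 Λ)} (hS : S ⊆ splitEdges C) {x y : Λ}
    (h : (edgeGraph S).Reachable x y) : x ∈ C ↔ y ∈ C := by
  have := eq_of_reachable (f := fun i => i ∈ C) (fun x y hxy => ?_) h
  · exact iff_of_eq this
  · rw [edgeGraph_adj] at hxy
    exact propext (mk_mem_splitEdges.1 (hS hxy.1)).2

/-- The bonds of an acyclic graph identify all spins with the spins at the roots of the trees, and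
the bonds of a graph with a cycle integrate to zero. -/
theorem gint_prod_edgeBond (C : Finset Λ) (S : Finset (Sym2 Λ)) (hS : S ⊆ splitEdges C) :
    ((edgeGraph S).IsAcyclic → ∃ r : Λ → Λ,
      (∀ x y, (edgeGraph S).Reachable x y ↔ r x = r y) ∧ (∀ x, r (r x) = r x) ∧
      ∀ X, gint (fun _ => 1) (offMass C) (centerVal (∏ e ∈ S, edgeBond C e) * X)
        = gint (fun k => if r k = k then 1 else 0) (fun k => if r k = k then offMass C k else 1)
            (subst r X)) ∧
    (¬(edgeGraph S).IsAcyclic → ∀ X,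
      gint (fun _ => 1) (offMass C) (centerVal (∏ e ∈ S, edgeBond C e) * X) = 0) := by
  induction S using Finset.induction_on with
  | empty =>
    have hbot : edgeGraph (∅ : Finset (Sym2 Λ)) = ⊥ := by simp [edgeGraph]
    refine ⟨fun _ => ⟨id, fun x y => ?_, fun _ => rfl, fun X => ?_⟩, fun h => absurd ?_ h⟩
    · rw [hbot, SimpleGraph.reachable_bot, id, id]
    · simp [subst_id]
    · rw [hbot]; exact SimpleGraph.isAcyclic_bot
  | insert e S he ih =>
    obtain ⟨hac, hcyc⟩ := ih ((Finset.subset_insert _ _).trans hS)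
    have hSS : S ⊆ splitEdges C := (Finset.subset_insert _ _).trans hS
    induction e using Sym2.ind with
    | _ i j =>
    obtain ⟨hij, hC⟩ := mk_mem_splitEdges.1 (hS (Finset.mem_insert_self _ _))
    have hG : edgeGraph (insert s(i, j) S) = edgeGraph S ⊔ SimpleGraph.edge i j := by
      rw [edgeGraph, edgeGraph, SimpleGraph.edge, Finset.coe_insert,
        Set.insert_eq, Set.union_comm, SimpleGraph.fromEdgeSet_union]
    have hnadj : ¬(edgeGraph S).Adj i j := by
      rw [edgeGraph_adj]
      exact fun h => he h.1
    have hexp : ∀ X, centerVal (∏ e ∈ insert s(i, j) S, edgeBond C e) * X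
        = centerVal (∏ e ∈ S, edgeBond C e) * (centerVal (edgeBond C s(i, j)) * X) := by
      intro X
      rw [Finset.prod_insert he, mul_comm, map_mul, mul_assoc]
    have hiff : (edgeGraph (insert s(i, j) S)).IsAcyclic ↔
        (edgeGraph S).IsAcyclic ∧ ¬(edgeGraph S).Reachable i j := by
      rw [hG, SimpleGraph.isAcyclic_sup_fromEdgeSet_iff]
      tauto
    constructor
    · intro h
      obtain ⟨h1, h2⟩ := hiff.1 h
      obtain ⟨r, hr, hrr, hX⟩ := hac h1
      have hab : r i ≠ r j := fun h => h2 ((hr i j).2 h)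
      -- The tree of `i` is merged into the tree of `j`, so the new roots are the old ones except `r
      -- i`.
      have hfix : ∀ k, (Function.update id (r i) (r j) ∘ r) k = k ↔ r k = k ∧ k ≠ r i := by
        intro k
        simp only [Function.comp_apply]
        by_cases hk : r k = r i
        · rw [hk, Function.update_self]
          constructor
          · intro h
            rw [← h, hrr] at hk
            exact absurd hk.symm hab
          · rintro ⟨h, h'⟩
            exact absurd h.symm h'
        · rw [Function.update_of_ne hk, id]
          refine ⟨fun h => ⟨h, fun h' => hk ?_⟩, fun h => h.1⟩
          rw [h', hrr]
      refine ⟨Function.update id (r i) (r j) ∘ r, fun x y => ⟨fun hxy => ?_, fun hxy => ?_⟩,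
        fun x => ?_, fun X => ?_⟩
      · refine eq_of_reachable (fun x y hadj => ?_) hxy
        rw [hG, SimpleGraph.sup_adj, SimpleGraph.edge_adj] at hadj
        simp only [Function.comp_apply]
        rcases hadj with hadj | ⟨⟨rfl, rfl⟩ | ⟨rfl, rfl⟩, _⟩
        · rw [(hr x y).1 hadj.reachable]
        · simp [hab.symm]
        · simp [hab.symm]
      · have hmono : ∀ {x y}, (edgeGraph S).Reachable x y →
            (edgeGraph (insert s(i, j) S)).Reachable x y := fun h =>
          h.mono (by rw [hG]; exact le_sup_left)
        have hijr : (edgeGraph (insert s(i, j) S)).Reachable i j := by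
          refine SimpleGraph.Adj.reachable ?_
          rw [hG, SimpleGraph.sup_adj, SimpleGraph.edge_adj]
          exact Or.inr ⟨Or.inl ⟨rfl, rfl⟩, hij⟩
        have hxr : ∀ x, (edgeGraph (insert s(i, j) S)).Reachable x
            (Function.update id (r i) (r j) (r x)) := by
          intro x
          by_cases hx : r x = r i
          · rw [hx, Function.update_self]
            exact (hmono ((hr _ _).2 hx)).trans (hijr.trans (hmono ((hr _ _).2 (hrr j).symm)))
          · rw [Function.update_of_ne hx]
            exact hmono ((hr _ _).2 (hrr x).symm)
        simp only [Function.comp_apply] at hxy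
        exact (hxr x).trans (hxy ▸ (hxr y).symm)
      · rw [hfix]
        simp only [Function.comp_apply]
        by_cases hx : r x = r i
        · rw [hx, Function.update_self]
          exact ⟨hrr j, hab.symm⟩
        · rw [Function.update_of_ne hx]
          exact ⟨hrr x, hx⟩
      -- No edge leaves or enters `C`, so the mass is constant on a tree and takes values 0 and 1.
      -- Hence the product of masses defining the bond constant equals the mass at the contracted
      -- root `r i`, as the contraction rule requires.
      · have hmi : offMass C (r i) = offMass C i := by
          simp only [offMass, mem_iff_of_reachable hSS ((hr _ _).2 (hrr i))]
        have hmj : offMass C j = offMass C i := by simp only [offMass, hC]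
        have hsq : offMass C i * offMass C i = offMass C i := by
          simp only [offMass]; split_ifs <;> simp
        rw [hexp, hX, map_mul, edgeBond_mk, subst_bond, hmj, hsq]
        have hrule := gint_bond_mul (fun k => if r k = k then 1 else 0)
          (fun k => if r k = k then offMass C k else 1) hab (if_pos (hrr i)) (subst r X)
        rw [if_pos (hrr i), hmi, subst_subst] at hrule
        rw [hrule]
        congr 2 <;> funext k <;> by_cases hk : k = r i
        · rw [hk, Function.update_self, if_neg (fun h => ((hfix _).1 h).2 rfl)]
        · rw [Function.update_of_ne hk]
          simp only [hfix, hk, ne_eq, not_false_eq_true, and_true]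
        · rw [hk, Function.update_self, if_neg (fun h => ((hfix _).1 h).2 rfl)]
        · rw [Function.update_of_ne hk]
          simp only [hfix, hk, ne_eq, not_false_eq_true, and_true]
    · intro h X
      rw [hexp]
      by_cases h1 : (edgeGraph S).IsAcyclic
      · have h2 : (edgeGraph S).Reachable i j := by
          by_contra h2
          exact h (hiff.2 ⟨h1, h2⟩)
        obtain ⟨r, hr, hrr, hX⟩ := hac h1
        -- The edge closes a cycle: both its ends have already become the same root, and the bond of
        -- a site with itself vanishes.
        rw [hX, map_mul, edgeBond_mk, subst_bond, (hr i j).1 h2, bond_self, map_zero, zero_mul,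
          map_zero]
      · exact hcyc h1 _

end Sites

section ForestExpansion

/-! ### Forest expansions -/

/-! ### Sums and products over the trees of a forest -/

section Trees

variable {Λ : Type*} [Fintype Λ]

open scoped Classical in
/-- The sum of a function over the vertices of a tree. -/
def treeSum (h : Λ → ℝ) {F : SimpleGraph Λ} (T : F.ConnectedComponent) : ℝ :=
  ∑ i ∈ Finset.univ.filter (fun i => i ∈ T.supp), h i

open scoped Classical in
/-- The product of a function of the trees of a forest. -/
def treeProd {F : SimpleGraph Λ} (g : F.ConnectedComponent → ℝ) : ℝ := ∏ T, g T

open scoped Classical in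
/-- The product of a function of the edges of a graph. -/
def edgeProd (β : Sym2 Λ → ℝ) (F : SimpleGraph Λ) : ℝ := ∏ e ∈ F.edgeFinset, β e

theorem forestWeight_eq (β : Sym2 Λ → ℝ) (h : Λ → ℝ) (F : SimpleGraph Λ) :
    forestWeight β h F = edgeProd β F * treeProd fun T : F.ConnectedComponent => 1 + treeSum h T :=
  rfl

theorem treeProd_eq {F : SimpleGraph Λ} [i : Fintype F.ConnectedComponent]
    (g : F.ConnectedComponent → ℝ) : treeProd g = ∏ T, g T := by
  unfold treeProd
  congr!

theorem edgeProd_eq (β : Sym2 Λ → ℝ) {F : SimpleGraph Λ} {S : Finset (Sym2 Λ)}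
    (hS : (S : Set (Sym2 Λ)) = F.edgeSet) : edgeProd β F = ∏ e ∈ S, β e := by
  unfold edgeProd
  refine Finset.prod_congr ?_ fun _ _ => rfl
  rw [← Finset.coe_inj, SimpleGraph.coe_edgeFinset, hS]

theorem treeSum_eq (h : Λ → ℝ) {F : SimpleGraph Λ} (v : Λ) {s : Finset Λ}
    (hs : ∀ i, i ∈ s ↔ F.Reachable i v) :
    treeSum h (F.connectedComponentMk v) = ∑ i ∈ s, h i := by
  classical
  unfold treeSum
  refine Finset.sum_congr ?_ fun _ _ => rfl
  ext i
  rw [hs, Finset.mem_filter, SimpleGraph.ConnectedComponent.mem_supp_iff,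
    SimpleGraph.ConnectedComponent.eq]
  simp

open scoped Classical in
/-- The weight of a tree that is not rooted: `0` for trees inside of `C`, and `1` for others. -/
def treeMass (C : Finset Λ) {F : SimpleGraph Λ} (T : F.ConnectedComponent) : ℝ :=
  if T.supp ⊆ (C : Set Λ) then 0 else 1

theorem treeSum_congr {h h' : Λ → ℝ} {F : SimpleGraph Λ} {T : F.ConnectedComponent}
    (H : ∀ i, F.connectedComponentMk i = T → h i = h' i) : treeSum h T = treeSum h' T := by
  classical
  exact Finset.sum_congr rfl fun i hi => H i (Finset.mem_filter.1 hi).2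

theorem treeSum_const {F : SimpleGraph Λ} (c : ℝ) (v : Λ) :
    treeSum (fun _ => c) (F.connectedComponentMk v) = c * treeSize F v := by
  classical
  unfold treeSum treeSize
  rw [Finset.sum_const, nsmul_eq_mul, mul_comm, Set.ncard_eq_toFinset_card']
  congr 3
  ext i
  simp

open scoped Classical in
/-- The acyclic graphs on a finite vertex set. -/
def acyclicGraphs (Λ : Type*) [Fintype Λ] : Finset (SimpleGraph Λ) :=
  Finset.univ.filter fun F => F.IsAcyclic

theorem mem_acyclicGraphs {F : SimpleGraph Λ} : F ∈ acyclicGraphs Λ ↔ F.IsAcyclic := by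
  simp [acyclicGraphs]

theorem mem_forests {β : Sym2 Λ → ℝ} {F : SimpleGraph Λ} :
    F ∈ forests β ↔ F ≤ weightGraph β ∧ F.IsAcyclic := by
  simp [forests]

theorem edgeProd_eq_zero {β : Sym2 Λ → ℝ} {F : SimpleGraph Λ} (hF : ¬F ≤ weightGraph β) :
    edgeProd β F = 0 := by
  classical
  rw [SimpleGraph.le_iff_adj] at hF
  push Not at hF
  obtain ⟨i, j, hij, hn⟩ := hF
  have hβ : β s(i, j) = 0 := by
    by_contra hne
    exact hn ⟨hij.ne, hne⟩
  exact Finset.prod_eq_zero (SimpleGraph.mem_edgeFinset.2 hij) hβ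

/-- A forest using an edge of zero weight contributes nothing, so the index set can be made
independent of `β`. -/
theorem sum_forests_eq_sum_acyclicGraphs (β : Sym2 Λ → ℝ) (X : SimpleGraph Λ → ℝ) :
    ∑ F ∈ forests β, edgeProd β F * X F = ∑ F ∈ acyclicGraphs Λ, edgeProd β F * X F := by
  refine Finset.sum_subset (fun F hF => mem_acyclicGraphs.2 (mem_forests.1 hF).2)
    fun F hF hF' => ?_
  rw [edgeProd_eq_zero fun h => hF' (mem_forests.2 ⟨h, mem_acyclicGraphs.1 hF⟩), zero_mul]

theorem treeProd_nonneg {F : SimpleGraph Λ} {g : F.ConnectedComponent → ℝ} (hg : ∀ T, 0 ≤ g T) :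
    0 ≤ treeProd g :=
  Finset.prod_nonneg fun T _ => hg T

theorem treeSum_nonneg {h : Λ → ℝ} (hh : ∀ i, 0 ≤ h i) {F : SimpleGraph Λ}
    (T : F.ConnectedComponent) : 0 ≤ treeSum h T :=
  Finset.sum_nonneg fun i _ => hh i

theorem treeProd_pos {F : SimpleGraph Λ} {g : F.ConnectedComponent → ℝ} (hg : ∀ T, 0 < g T) :
    0 < treeProd g :=
  Finset.prod_pos fun T _ => hg T

end Trees

variable {Λ : Type*} [DecidableEq Λ] [Fintype Λ]

/-- The sets of edges of the forests that have no edge between `C` and its complement. -/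
def forestEdgeSets (C : Finset Λ) : Finset (Finset (Sym2 Λ)) := by
  classical exact (splitEdges C).powerset.filter fun S => (edgeGraph S).IsAcyclic

theorem mem_forestEdgeSets {C : Finset Λ} {S : Finset (Sym2 Λ)} :
    S ∈ forestEdgeSets C ↔ S ⊆ splitEdges C ∧ (edgeGraph S).IsAcyclic := by
  simp [forestEdgeSets]

theorem subst_prod_siteElt (r : Λ → Λ) (h : Λ → ℝ) :
    subst r (centerVal (∏ i, siteElt 1 (h i) i)) = centerVal (∏ i, siteElt 1 (h i) (r i)) := by
  have key : ∀ s : Finset Λ,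
      subst r (centerVal (∏ i ∈ s, siteElt 1 (h i) i))
        = centerVal (∏ i ∈ s, siteElt 1 (h i) (r i)) := by
    intro s
    induction s using Finset.induction_on with
    | empty => simp
    | insert a s ha ih =>
      rw [Finset.prod_insert ha, Finset.prod_insert ha, map_mul, map_mul, map_mul, ih]
      congr 1
      simp only [siteElt, map_add, centerVal_smul, map_smul, subst_pair, centerVal_algebraMap,
        AlgHom.commutes]
  exact key _

theorem prod_siteElt_const (s : Finset Λ) (h : Λ → ℝ) (k : Λ) :
    ∏ i ∈ s, siteElt 1 (h i) k = siteElt 1 (∑ i ∈ s, h i) k := by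
  induction s using Finset.induction_on with
  | empty => simp [siteElt]
  | insert a s ha ih =>
    rw [Finset.prod_insert ha, Finset.sum_insert ha, ih, siteElt_one_mul_add]

theorem treeMass_mk {C : Finset Λ} {S : Finset (Sym2 Λ)} (hS : S ⊆ splitEdges C) (k : Λ) :
    treeMass C ((edgeGraph S).connectedComponentMk k) = offMass C k := by
  rw [treeMass, offMass]
  congr 1
  refine propext ⟨fun h => h rfl, fun h i hi => ?_⟩
  exact (mem_iff_of_reachable hS (SimpleGraph.ConnectedComponent.eq.1 hi)).2 h

/-- The integral of the bonds of a forest factorizes over its trees. -/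
theorem gint_forest {C : Finset Λ} {S : Finset (Sym2 Λ)} (hS : S ∈ forestEdgeSets C)
    (h : Λ → ℝ) :
    gint (fun _ => 1) (offMass C)
        (centerVal ((∏ e ∈ S, edgeBond C e) * ∏ i, siteElt 1 (h i) i))
      = treeProd fun T : (edgeGraph S).ConnectedComponent => treeMass C T + treeSum h T := by
  classical
  obtain ⟨hSC, hac⟩ := mem_forestEdgeSets.1 hS
  obtain ⟨r, hr, hrr, hX⟩ := (gint_prod_edgeBond C S hSC).1 hac
  have hfib : ∏ i, siteElt 1 (h i) (r i)
      = ∏ k, siteElt 1 (∑ i ∈ Finset.univ.filter (fun i => r i = k), h i) k := by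
    rw [← Finset.prod_fiberwise Finset.univ r]
    refine Finset.prod_congr rfl fun k _ => ?_
    rw [← prod_siteElt_const]
    refine Finset.prod_congr rfl fun i hi => ?_
    rw [(Finset.mem_filter.1 hi).2]
  rw [map_mul, hX, subst_prod_siteElt, hfib, gint_prod_siteElt]
  -- Contracted sites contribute 1; a root contributes its mass plus the field accumulated from its
  -- whole tree.
  have h1 : ∀ k, ((if r k = k then offMass C k else 1)
      + (if r k = k then 1 else 0) * ∑ i ∈ Finset.univ.filter (fun i => r i = k), h i)
      = if r k = k then offMass C k + ∑ i ∈ Finset.univ.filter (fun i => r i = k), h i else 1 := by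
    intro k
    split_ifs <;> simp
  simp only [h1]
  rw [← Finset.prod_filter, treeProd_eq]
  refine Finset.prod_bij (fun k _ => (edgeGraph S).connectedComponentMk k)
    (fun _ _ => Finset.mem_univ _) (fun a ha b hb hab => ?_) (fun T _ => ?_) (fun k hk => ?_)
  · rw [← (Finset.mem_filter.1 ha).2, ← (Finset.mem_filter.1 hb).2]
    exact (hr a b).1 (SimpleGraph.ConnectedComponent.eq.1 hab)
  · induction T using SimpleGraph.ConnectedComponent.ind with
    | _ v =>
      exact ⟨r v, by simp [hrr], SimpleGraph.ConnectedComponent.eq.2 ((hr _ _).2 (hrr v))⟩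
  · rw [treeMass_mk hSC]
    congr 1
    refine (treeSum_eq h k fun i => ?_).symm
    rw [hr, (Finset.mem_filter.1 hk).2]
    simp

/-- The Boltzmann weight `∏_e (1 + β_e f_e) ∏_i (1 + h_i ξ_i η_i)`. -/
def boltzmann (C : Finset Λ) (β : Sym2 Λ → ℝ) (h : Λ → ℝ) : GrassmannCenter Λ :=
  (∏ e ∈ splitEdges C, (1 + β e • edgeBond C e)) * ∏ i, siteElt 1 (h i) i

/-- The partition function of forests that do not connect `C` to its complement, in which the
trees in `C` are rooted. -/
def splitPartition (C : Finset Λ) (β : Sym2 Λ → ℝ) (h : Λ → ℝ) : ℝ :=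
  gint (fun _ => 1) (offMass C) (centerVal (boltzmann C β h))

theorem splitPartition_eq_sum (C : Finset Λ) (β : Sym2 Λ → ℝ) (h : Λ → ℝ) :
    splitPartition C β h = ∑ S ∈ forestEdgeSets C, (∏ e ∈ S, β e) *
      treeProd fun T : (edgeGraph S).ConnectedComponent => treeMass C T + treeSum h T := by
  have hterm : ∀ S : Finset (Sym2 Λ), gint (fun _ => 1) (offMass C)
      (centerVal ((∏ e ∈ S, β e • edgeBond C e) * ∏ i, siteElt 1 (h i) i))
      = (∏ e ∈ S, β e) * gint (fun _ => 1) (offMass C)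
        (centerVal ((∏ e ∈ S, edgeBond C e) * ∏ i, siteElt 1 (h i) i)) := by
    intro S
    rw [Finset.prod_smul, smul_mul_assoc, centerVal_smul, map_smul, smul_eq_mul]
  rw [splitPartition, boltzmann, Finset.prod_one_add, Finset.sum_mul, map_sum, map_sum]
  have hsub : forestEdgeSets C ⊆ (splitEdges C).powerset := fun S hS =>
    Finset.mem_powerset.2 (mem_forestEdgeSets.1 hS).1
  rw [← Finset.sum_subset hsub]
  · refine Finset.sum_congr rfl fun S hS => ?_
    rw [hterm, gint_forest hS]
  · intro S hS hS'
    have hSC := Finset.mem_powerset.1 hS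
    rw [hterm, map_mul, (gint_prod_edgeBond C S hSC).2, mul_zero]
    exact fun h => hS' (mem_forestEdgeSets.2 ⟨hSC, h⟩)

/-! ### Forests and their sets of edges -/

theorem sum_forests_eq (β : Sym2 Λ → ℝ) (X : SimpleGraph Λ → ℝ) :
    ∑ F ∈ forests β, edgeProd β F * X F
      = ∑ S ∈ forestEdgeSets ∅, (∏ e ∈ S, β e) * X (edgeGraph S) := by
  classical
  rw [sum_forests_eq_sum_acyclicGraphs]
  have hgr : ∀ S ∈ forestEdgeSets (∅ : Finset Λ), (S : Set (Sym2 Λ)) = (edgeGraph S).edgeSet := by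
    intro S hS
    rw [edgeGraph, SimpleGraph.edgeSet_fromEdgeSet]
    refine Set.ext fun e => ⟨fun he => ⟨he, ?_⟩, fun he => he.1⟩
    exact (mem_splitEdges.1 ((mem_forestEdgeSets.1 hS).1 he)).1
  symm
  refine Finset.sum_bij (fun S _ => edgeGraph S) (fun S hS => ?_) (fun S hS S' hS' h => ?_)
    (fun F hF => ?_) (fun S hS => ?_)
  · exact mem_acyclicGraphs.2 (mem_forestEdgeSets.1 hS).2
  · rw [← Finset.coe_inj, hgr S hS, hgr S' hS', h]
  · have hF' : edgeGraph F.edgeFinset = F := by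
      rw [edgeGraph, SimpleGraph.coe_edgeFinset, SimpleGraph.fromEdgeSet_edgeSet]
    refine ⟨F.edgeFinset, mem_forestEdgeSets.2 ⟨fun e he => mem_splitEdges.2 ⟨?_, by simp⟩, ?_⟩, hF'⟩
    · exact F.not_isDiag_of_mem_edgeSet (SimpleGraph.mem_edgeFinset.1 he)
    · rw [hF']
      exact mem_acyclicGraphs.1 hF
  · rw [edgeProd_eq β (hgr S hS)]

theorem partitionFunction_eq_sum (β : Sym2 Λ → ℝ) (h : Λ → ℝ) :
    partitionFunction β h = ∑ S ∈ forestEdgeSets ∅, (∏ e ∈ S, β e) *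
      treeProd fun T : (edgeGraph S).ConnectedComponent => 1 + treeSum h T := by
  rw [← sum_forests_eq β fun F => treeProd fun T : F.ConnectedComponent => 1 + treeSum h T]
  rfl

theorem splitPartition_empty (β : Sym2 Λ → ℝ) (h : Λ → ℝ) :
    splitPartition ∅ β h = partitionFunction β h := by
  rw [splitPartition_eq_sum, partitionFunction_eq_sum]
  refine Finset.sum_congr rfl fun S hS => ?_
  congr 2
  funext T
  congr 1
  induction T using SimpleGraph.ConnectedComponent.ind with
  | _ v => rw [treeMass_mk (mem_forestEdgeSets.1 hS).1, offMass, if_neg (by simp)]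

/-! ### Splitting a forest into its rooted and its other trees -/

/-- The restriction of the external field to `C`. -/
def restrict (C : Finset Λ) (h : Λ → ℝ) (i : Λ) : ℝ := if i ∈ C then h i else 0

-- Expanding `∏_{T ∈ U} (1 + ∑ h_i)` selects a set `A ⊆ U` of rooted trees, and `A` corresponds to
-- the union `C` of their vertices. Trees in `A` have mass 0 and keep their field; the others have
-- mass 1 and restricted field 0.
open scoped Classical in
theorem sum_prod_treeMass {S : Finset (Sym2 Λ)} (hS : S ⊆ splitEdges ∅) (h : Λ → ℝ)
    (U : Finset (edgeGraph S).ConnectedComponent) :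
    ∑ C ∈ Finset.univ.filter (fun C : Finset Λ => S ⊆ splitEdges C ∧
        ∀ i ∈ C, (edgeGraph S).connectedComponentMk i ∈ U),
      treeProd (fun T : (edgeGraph S).ConnectedComponent =>
        treeMass C T + treeSum (restrict C h) T)
      = treeProd fun T => if T ∈ U then 1 + treeSum h T else 1 := by
  rw [treeProd_eq, ← Finset.prod_filter, Finset.filter_mem_eq_inter, Finset.univ_inter,
    Finset.prod_one_add]
  symm
  let G := edgeGraph S
  let un : Finset G.ConnectedComponent → Finset Λ := fun A =>
    Finset.univ.filter fun i => G.connectedComponentMk i ∈ A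
  have hun : ∀ A i, i ∈ un A ↔ G.connectedComponentMk i ∈ A := fun A i => by simp [un]
  have hcompat : ∀ A, S ⊆ splitEdges (un A) := by
    intro A e he
    induction e using Sym2.ind with
    | _ i j =>
      have hij := (mk_mem_splitEdges.1 (hS he)).1
      refine mk_mem_splitEdges.2 ⟨hij, ?_⟩
      have hadj : G.Adj i j := edgeGraph_adj.2 ⟨he, hij⟩
      rw [hun, hun, SimpleGraph.ConnectedComponent.eq.2 hadj.reachable]
  refine Finset.sum_bij (fun A _ => un A) (fun A hA => ?_) (fun A _ B _ hAB => ?_)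
    (fun C hC => ?_) (fun A hA => ?_)
  · refine Finset.mem_filter.2 ⟨Finset.mem_univ _, hcompat A, fun i hi => ?_⟩
    exact Finset.mem_powerset.1 hA ((hun A i).1 hi)
  · ext T
    induction T using SimpleGraph.ConnectedComponent.ind with
    | _ v => rw [← hun, ← hun, hAB]
  · obtain ⟨hSC, hCU⟩ := (Finset.mem_filter.1 hC).2
    refine ⟨C.image G.connectedComponentMk, ?_, ?_⟩
    · rw [Finset.mem_powerset]
      intro T hT
      obtain ⟨i, hi, rfl⟩ := Finset.mem_image.1 hT
      exact hCU i hi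
    · ext i
      rw [hun, Finset.mem_image]
      constructor
      · rintro ⟨j, hj, hji⟩
        exact (mem_iff_of_reachable hSC (SimpleGraph.ConnectedComponent.eq.1 hji)).1 hj
      · exact fun hi => ⟨i, hi, rfl⟩
  · rw [treeProd_eq, ← Finset.prod_subset (Finset.subset_univ A)]
    · refine Finset.prod_congr rfl fun T hT => ?_
      induction T using SimpleGraph.ConnectedComponent.ind with
      | _ v =>
        rw [treeMass_mk (hcompat A), offMass, if_pos ((hun A v).2 hT), zero_add]
        refine treeSum_congr fun i hi => ?_
        rw [restrict, if_pos]
        rw [hun, show G.connectedComponentMk i = _ from hi]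
        exact hT
    · intro T _ hT
      induction T using SimpleGraph.ConnectedComponent.ind with
      | _ v =>
        rw [treeMass_mk (hcompat A), offMass, if_neg (fun h => hT ((hun A v).1 h)),
          add_eq_left]
        refine (treeSum_congr (h' := fun _ => 0) fun i hi => ?_).trans Finset.sum_const_zero
        rw [restrict, if_neg]
        rw [hun, show G.connectedComponentMk i = _ from hi]
        exact hT

open scoped Classical in
theorem sum_splitPartition_filter (β : Sym2 Λ → ℝ) (h : Λ → ℝ) (p : Finset Λ → Prop) :
    ∑ C ∈ Finset.univ.filter p, splitPartition C β (restrict C h)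
      = ∑ S ∈ forestEdgeSets ∅, (∏ e ∈ S, β e) *
        ∑ C ∈ Finset.univ.filter (fun C : Finset Λ => S ⊆ splitEdges C ∧ p C),
          treeProd fun T : (edgeGraph S).ConnectedComponent => treeMass C T + treeSum (restrict C h) T := by
  simp only [splitPartition_eq_sum, Finset.mul_sum]
  refine Finset.sum_comm' fun C S => ?_
  simp only [Finset.mem_filter, Finset.mem_univ, true_and, mem_forestEdgeSets]
  have hsub : splitEdges C ⊆ splitEdges ∅ := fun e he =>
    mem_splitEdges.2 ⟨(mem_splitEdges.1 he).1, by simp⟩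
  constructor
  · rintro ⟨hp, hS, hac⟩
    exact ⟨⟨hS, hp⟩, hS.trans hsub, hac⟩
  · rintro ⟨⟨hS, hp⟩, _, hac⟩
    exact ⟨hp, hS, hac⟩

/-- Every forest is split into rooted trees, which cover `C`, and other trees. -/
theorem sum_splitPartition (β : Sym2 Λ → ℝ) (h : Λ → ℝ) :
    ∑ C : Finset Λ, splitPartition C β (restrict C h) = partitionFunction β h := by
  classical
  have e := sum_splitPartition_filter β h (fun _ => True)
  rw [Finset.filter_true] at e
  rw [e, partitionFunction_eq_sum]
  refine Finset.sum_congr rfl fun S hS => ?_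
  have := sum_prod_treeMass (mem_forestEdgeSets.1 hS).1 h Finset.univ
  simp only [Finset.mem_univ, if_true, implies_true] at this
  rw [← this]
  congr!

-- The condition `x ∉ C` says that the tree of `x` is not rooted, so its factor is 1; this is the
-- expansion with `U` all trees but that one.
open scoped Classical in
theorem sum_splitPartition_notMem (β : Sym2 Λ → ℝ) (h : Λ → ℝ) (x : Λ) :
    ∑ C ∈ Finset.univ.filter (fun C : Finset Λ => x ∉ C), splitPartition C β (restrict C h)
      = ∑ S ∈ forestEdgeSets ∅, (∏ e ∈ S, β e) *
        treeProd fun T : (edgeGraph S).ConnectedComponent =>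
          if T = (edgeGraph S).connectedComponentMk x then 1 else 1 + treeSum h T := by
  refine Eq.trans ?_ ((sum_splitPartition_filter β h fun C => x ∉ C).trans ?_)
  · congr!
  refine Finset.sum_congr rfl fun S hS => ?_
  congr 1
  have := sum_prod_treeMass (mem_forestEdgeSets.1 hS).1 h
    (Finset.univ.erase ((edgeGraph S).connectedComponentMk x))
  simp only [Finset.mem_erase, Finset.mem_univ, and_true, ne_eq, ite_not] at this
  rw [← this]
  refine Finset.sum_congr ?_ fun _ _ => rfl
  ext C
  simp only [Finset.mem_filter, Finset.mem_univ, true_and]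
  refine and_congr_right fun hSC => ?_
  constructor
  · intro hx i hi hix
    exact hx ((mem_iff_of_reachable hSC (SimpleGraph.ConnectedComponent.eq.1 hix)).1 hi)
  · exact fun hC hx => hC x hx rfl

/-! ### Unit increments of the external field -/

open scoped Classical in
theorem treeSum_add_single (h : Λ → ℝ) (x : Λ) {F : SimpleGraph Λ} (T : F.ConnectedComponent) :
    treeSum (h + Pi.single x 1) T
      = treeSum h T + if T = F.connectedComponentMk x then 1 else 0 := by
  simp only [treeSum, Pi.add_apply, Finset.sum_add_distrib, Pi.single_apply]
  congr 1
  rw [Finset.sum_ite_eq']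
  simp [SimpleGraph.ConnectedComponent.mem_supp_iff, eq_comm]

open scoped Classical in
/-- Increasing the field at `x` by one adds the weight without the tree of `x`. -/
theorem treeProd_add_single {F : SimpleGraph Λ} (m : F.ConnectedComponent → ℝ) (h : Λ → ℝ)
    (x : Λ) :
    treeProd (fun T => m T + treeSum (h + Pi.single x 1) T)
        - treeProd (fun T => m T + treeSum h T)
      = treeProd fun T => if T = F.connectedComponentMk x then 1 else m T + treeSum h T := by
  have key : ∀ g : F.ConnectedComponent → ℝ, treeProd g = g (F.connectedComponentMk x) *
      ∏ T ∈ Finset.univ.erase (F.connectedComponentMk x), g T := fun g => by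
    rw [treeProd_eq, Finset.mul_prod_erase _ _ (Finset.mem_univ _)]
  have e : ∀ g g' : F.ConnectedComponent → ℝ, (∀ T, T ≠ F.connectedComponentMk x → g T = g' T) →
      ∏ T ∈ Finset.univ.erase (F.connectedComponentMk x), g T
        = ∏ T ∈ Finset.univ.erase (F.connectedComponentMk x), g' T := fun g g' H =>
    Finset.prod_congr rfl fun T hT => H T (Finset.ne_of_mem_erase hT)
  rw [key, key, key, treeSum_add_single, if_pos rfl, if_pos rfl,
    e _ (fun T => m T + treeSum h T) (fun T hT => by rw [treeSum_add_single, if_neg hT, add_zero]),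
    e (fun T => if T = F.connectedComponentMk x then 1 else m T + treeSum h T)
      (fun T => m T + treeSum h T) (fun T hT => if_neg hT)]
  ring

open scoped Classical in
theorem partitionFunction_add_single (β : Sym2 Λ → ℝ) (h : Λ → ℝ) (x : Λ) :
    partitionFunction β (h + Pi.single x 1) - partitionFunction β h
      = ∑ S ∈ forestEdgeSets ∅, (∏ e ∈ S, β e) *
        treeProd fun T : (edgeGraph S).ConnectedComponent =>
          if T = (edgeGraph S).connectedComponentMk x then 1 else 1 + treeSum h T := by
  rw [partitionFunction_eq_sum, partitionFunction_eq_sum, ← Finset.sum_sub_distrib]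
  refine Finset.sum_congr rfl fun S _ => ?_
  rw [← mul_sub, treeProd_add_single (fun _ => 1)]

/-- Both sides count forests with the factor of the tree of `x` replaced by 1. After division by `Z`
this identifies the probability that `x` is not rooted. -/
theorem sum_splitPartition_notMem_eq (β : Sym2 Λ → ℝ) (h : Λ → ℝ) (x : Λ) :
    ∑ C : Finset Λ, (if x ∈ C then 0 else splitPartition C β (restrict C h))
      = partitionFunction β (h + Pi.single x 1) - partitionFunction β h := by
  classical
  rw [partitionFunction_add_single, ← sum_splitPartition_notMem, Finset.sum_filter]
  refine Finset.sum_congr rfl fun C _ => ?_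
  rw [ite_not]

theorem treeMass_nonneg (C : Finset Λ) {F : SimpleGraph Λ} (T : F.ConnectedComponent) :
    0 ≤ treeMass C T := by
  unfold treeMass
  split_ifs <;> norm_num

theorem splitPartition_nonneg {β : Sym2 Λ → ℝ} (hβ : ∀ e, 0 ≤ β e) {h : Λ → ℝ} (hh : ∀ i, 0 ≤ h i)
    (C : Finset Λ) : 0 ≤ splitPartition C β h := by
  rw [splitPartition_eq_sum]
  exact Finset.sum_nonneg fun S _ => mul_nonneg (Finset.prod_nonneg fun e _ => hβ e)
    (treeProd_nonneg fun T => add_nonneg (treeMass_nonneg C T) (treeSum_nonneg hh T))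

theorem splitPartition_le_add_single {β : Sym2 Λ → ℝ} (hβ : ∀ e, 0 ≤ β e) {h : Λ → ℝ}
    (hh : ∀ i, 0 ≤ h i) (C : Finset Λ) (x : Λ) :
    splitPartition C β h ≤ splitPartition C β (h + Pi.single x 1) := by
  classical
  rw [← sub_nonneg, splitPartition_eq_sum, splitPartition_eq_sum, ← Finset.sum_sub_distrib]
  refine Finset.sum_nonneg fun S _ => ?_
  rw [← mul_sub, treeProd_add_single]
  refine mul_nonneg (Finset.prod_nonneg fun e _ => hβ e) (treeProd_nonneg fun T => ?_)
  split_ifs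
  · exact zero_le_one
  · exact add_nonneg (treeMass_nonneg C T) (treeSum_nonneg hh T)

end ForestExpansion

section SigmaModelForests

variable {Λ : Type*} [DecidableEq Λ] [Fintype Λ]

/-! ### The sigma model as a sum over forests -/

theorem exp_eq_one_add {A : Type*} [CommRing A] [Module ℚ A] {x : A} (hx : x * x = 0) :
    IsNilpotent.exp x = 1 + x := by
  rw [IsNilpotent.exp_eq_sum (k := 2) (by rw [pow_two, hx])]
  simp [Finset.sum_range_succ]

/-- Exponentials of commuting nilpotents multiply, and each square-zero term has exponential `1 +
x`. -/
theorem exp_sum_eq_prod {A ι : Type*} [CommRing A] [Algebra ℚ A] (s : Finset ι) (x : ι → A)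
    (hx : ∀ i ∈ s, x i * x i = 0) :
    IsNilpotent (∑ i ∈ s, x i) ∧ IsNilpotent.exp (∑ i ∈ s, x i) = ∏ i ∈ s, (1 + x i) := by
  classical
  induction s using Finset.induction_on with
  | empty => simp
  | insert a s ha ih =>
    have hs := ih fun i hi => hx i (Finset.mem_insert_of_mem hi)
    have h2 := hx a (Finset.mem_insert_self _ _)
    have hn : IsNilpotent (x a) := ⟨2, by rw [pow_two, h2]⟩
    rw [Finset.sum_insert ha, Finset.prod_insert ha]
    refine ⟨(Commute.all _ _).isNilpotent_add hn hs.1, ?_⟩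
    rw [IsNilpotent.exp_add_of_commute (Commute.all _ _) hn hs.1, exp_eq_one_add h2, hs.2]

theorem mem_splitEdges_empty {e : Sym2 Λ} : e ∈ splitEdges ∅ ↔ ¬e.IsDiag := by
  simp [mem_splitEdges]

theorem sum_sum_mk_eq {M : Type*} [AddCommMonoid M] (g : Sym2 Λ → M)
    (hg : ∀ i, g s(i, i) = 0) : ∑ i, ∑ j, g s(i, j) = 2 • ∑ e ∈ splitEdges ∅, g e := by
  have h0 : ∑ i, ∑ j, g s(i, j)
      = ∑ p ∈ (Finset.univ : Finset (Λ × Λ)).filter (fun p => p.1 ≠ p.2), g s(p.1, p.2) := by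
    rw [← Finset.sum_product', Finset.univ_product_univ]
    symm
    refine Finset.sum_subset (Finset.subset_univ _) fun p _ hp => ?_
    have : p.1 = p.2 := by simpa using hp
    rw [this, hg]
  have hmap : ∀ p ∈ (Finset.univ : Finset (Λ × Λ)).filter (fun p => p.1 ≠ p.2),
      s(p.1, p.2) ∈ splitEdges (∅ : Finset Λ) := fun p hp => by
    rw [mem_splitEdges_empty, Sym2.mk_isDiag_iff]
    exact (Finset.mem_filter.1 hp).2
  rw [h0, ← Finset.sum_fiberwise_of_maps_to hmap, Finset.smul_sum]
  refine Finset.sum_congr rfl fun e he => ?_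
  induction e using Sym2.ind with
  | _ i j =>
    have hij : i ≠ j := by simpa using mem_splitEdges_empty.1 he
    have hf : ((Finset.univ : Finset (Λ × Λ)).filter (fun p => p.1 ≠ p.2)).filter
        (fun p => s(p.1, p.2) = s(i, j)) = {(i, j), (j, i)} := by
      ext ⟨a, b⟩
      simp only [Finset.mem_filter, Finset.mem_univ, true_and, Finset.mem_insert,
        Finset.mem_singleton, Prod.mk.injEq, Sym2.eq_iff]
      constructor
      · exact fun h => h.2
      · rintro (⟨rfl, rfl⟩ | ⟨rfl, rfl⟩)
        · exact ⟨hij, Or.inl ⟨rfl, rfl⟩⟩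
        · exact ⟨hij.symm, Or.inr ⟨rfl, rfl⟩⟩
    rw [hf, Finset.sum_pair (by simp [hij]), two_smul, Sym2.eq_swap (a := j)]

theorem z_eq (i : Λ) : z i = centerVal (1 - pair i i) := by
  rw [map_sub, map_one, centerVal_pair, z]

theorem dot_eq (i j : Λ) : dot i j = centerVal (bond 1 i j - 1) := by
  rw [dot, z_eq, z_eq, ← centerVal_pair, ← centerVal_pair, ← map_mul, ← map_neg, ← map_sub,
    ← map_sub, bond, one_smul]
  congr 1
  ring

theorem sqDist_eq (i j : Λ) : sqDist i j = (-2 : ℝ) • centerVal (bond 1 i j) := by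
  rw [sqDist, dot_eq, dot_eq, dot_eq, bond_self, bond_self, map_sub, map_sub, map_one, map_zero,
    smul_sub, neg_smul, two_smul, two_smul]
  abel

theorem edgeBond_empty (i j : Λ) : edgeBond ∅ s(i, j) = bond 1 i j := by
  simp [edgeBond_mk, offMass]

theorem edgeBond_mul_self (C : Finset Λ) (e : Sym2 Λ) : edgeBond C e * edgeBond C e = 0 := by
  induction e using Sym2.ind with
  | _ i j => exact bond_mul_self _ _ _

theorem neg_action_eq (β : Sym2 Λ → ℝ) (h : Λ → ℝ) : -action β h
    = centerVal (∑ e ∈ splitEdges ∅, β e • edgeBond ∅ e + ∑ i, h i • pair i i) := by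
  have h1 := sum_sum_mk_eq (fun e : Sym2 Λ => β e • edgeBond ∅ e)
    (fun i => by rw [edgeBond_empty, bond_self, smul_zero])
  -- Each squared distance is `-2` times a bond, and every edge appears in two orders; the resulting
  -- `-4` cancels the `1/4` of the action.
  have h2 : ∑ i, ∑ j, β s(i, j) • sqDist i j
      = (-4 : ℝ) • centerVal (∑ e ∈ splitEdges ∅, β e • edgeBond ∅ e) := by
    have : ∑ i, ∑ j, β s(i, j) • sqDist i j
        = (-2 : ℝ) • centerVal (∑ i, ∑ j, β s(i, j) • edgeBond ∅ s(i, j)) := by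
      simp only [map_sum, Finset.smul_sum, centerVal_smul, edgeBond_empty, sqDist_eq]
      refine Finset.sum_congr rfl fun i _ => Finset.sum_congr rfl fun j _ => ?_
      rw [smul_comm]
    rw [this, h1, map_nsmul, ← Nat.cast_smul_eq_nsmul ℝ, smul_smul]
    norm_num
  have h3 : ∀ i : Λ, h i • (z i - 1) = -(centerVal (h i • pair i i)) := by
    intro i
    rw [z_eq, map_sub, map_one, sub_sub_cancel_left, smul_neg, centerVal_smul]
  rw [action, h2, smul_smul, map_add, map_sum centerVal _ Finset.univ]
  simp only [h3, Finset.sum_neg_distrib]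
  norm_num
  rw [add_comm]

instance : Algebra ℚ (GrassmannCenter Λ) := Algebra.compHom _ (algebraMap ℚ ℝ)

theorem exp_neg_action (β : Sym2 Λ → ℝ) (h : Λ → ℝ) :
    IsNilpotent.exp (-action β h) = centerVal (boltzmann ∅ β h) := by
  obtain ⟨n1, e1⟩ := exp_sum_eq_prod (splitEdges ∅) (fun e : Sym2 Λ => β e • edgeBond ∅ e)
    fun e _ => by rw [smul_mul_smul_comm, edgeBond_mul_self, smul_zero]
  obtain ⟨n2, e2⟩ := exp_sum_eq_prod Finset.univ (fun i : Λ => h i • pair i i)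
    fun i _ => by rw [smul_mul_smul_comm, pair_mul_pair_self, smul_zero]
  rw [neg_action_eq, ← IsNilpotent.map_exp ((Commute.all _ _).isNilpotent_add n1 n2),
    IsNilpotent.exp_add_of_commute (Commute.all _ _) n1 n2, e1, e2, boltzmann]
  simp only [siteElt, map_one]

theorem unnormalisedExpectation_eq (β : Sym2 Λ → ℝ) (h : Λ → ℝ) (F : GrassmannCenter Λ) :
    unnormalisedExpectation β h (centerVal F)
      = gint (fun _ => 1) (offMass ∅) (centerVal (F * boltzmann ∅ β h)) := by
  rw [unnormalisedExpectation, exp_neg_action, integral_eq_gint, map_mul centerVal]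
  congr 2

/-- Because `(ξ_x η_x)² = 0`, one has `(1 + h ξ_x η_x)(1 + ξ_x η_x) = 1 + (h + 1) ξ_x η_x`. A unit
step of the field thus inserts `ξ_x η_x` exactly, and no derivative in `h` is needed. -/
theorem boltzmann_add_single (C : Finset Λ) (β : Sym2 Λ → ℝ) (h : Λ → ℝ) (x : Λ) :
    boltzmann C β (h + Pi.single x 1) = boltzmann C β h + pair x x * boltzmann C β h := by
  have e : ∏ i, siteElt 1 ((h + Pi.single x 1 : Λ → ℝ) i) i
      = (∏ i, siteElt 1 (h i) i) * siteElt 1 1 x := by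
    have : ∀ i, siteElt 1 ((h + Pi.single x 1 : Λ → ℝ) i) i
        = siteElt 1 (h i) i * if i = x then siteElt 1 1 i else 1 := by
      intro i
      rw [Pi.add_apply, ← siteElt_one_mul_add]
      congr 1
      by_cases hi : i = x
      · subst hi; simp
      · simp [hi, siteElt]
    simp only [this, Finset.prod_mul_distrib]
    rw [Finset.prod_ite_eq' Finset.univ x]
    simp
  rw [boltzmann, e, boltzmann, siteElt, one_smul, map_one]
  ring

theorem gint_pair_mul_boltzmann (C : Finset Λ) (β : Sym2 Λ → ℝ) (h : Λ → ℝ) (x : Λ) :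
    gint (fun _ => 1) (offMass C) (centerVal (pair x x * boltzmann C β h))
      = splitPartition C β (h + Pi.single x 1) - splitPartition C β h := by
  rw [splitPartition, splitPartition, boltzmann_add_single, map_add, map_add, add_sub_cancel_left]

theorem expectation_z (β : Sym2 Λ → ℝ) (h : Λ → ℝ) (x : Λ) : expectation β h (z x)
    = (partitionFunction β h - (partitionFunction β (h + Pi.single x 1) - partitionFunction β h))
      / partitionFunction β h := by
  have h1 : unnormalisedExpectation β h 1 = partitionFunction β h := by
    rw [← map_one centerVal, unnormalisedExpectation_eq, one_mul, ← splitPartition_empty,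
      splitPartition]
  have h2 : unnormalisedExpectation β h (z x) = partitionFunction β h
      - (partitionFunction β (h + Pi.single x 1) - partitionFunction β h) := by
    rw [z_eq, unnormalisedExpectation_eq, sub_mul, one_mul, map_sub, map_sub,
      gint_pair_mul_boltzmann, splitPartition_empty, splitPartition_empty, ← splitPartition,
      splitPartition_empty]
  rw [expectation, h1, h2]

theorem partitionFunction_pos {β : Sym2 Λ → ℝ} (hβ : ∀ e, 0 ≤ β e) {h : Λ → ℝ}
    (hh : ∀ i, 0 ≤ h i) : 0 < partitionFunction β h := by
  have hp : ∀ S : Finset (Sym2 Λ),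
      0 < treeProd fun T : (edgeGraph S).ConnectedComponent => 1 + treeSum h T := fun S =>
    treeProd_pos fun T => add_pos_of_pos_of_nonneg one_pos (treeSum_nonneg hh T)
  rw [partitionFunction_eq_sum]
  refine Finset.sum_pos' (fun S _ => mul_nonneg (Finset.prod_nonneg fun e _ => hβ e) (hp S).le)
    ⟨∅, mem_forestEdgeSets.2 ⟨Finset.empty_subset _, ?_⟩, ?_⟩
  · have : edgeGraph (∅ : Finset (Sym2 Λ)) = ⊥ := by simp [edgeGraph]
    rw [this]
    exact SimpleGraph.isAcyclic_bot
  · rw [Finset.prod_empty, one_mul]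
    exact hp _

/-- The magnetisation `⟨z_x⟩` in terms of the tree of `x`, for a nonnegative external field. -/
theorem expectation_z_eq_forestExpectation {β : Sym2 Λ → ℝ} (hβ : ∀ e, 0 ≤ β e) {h : Λ → ℝ}
    (hh : ∀ i, 0 ≤ h i) (x : Λ) :
    expectation β h (z x) = forestExpectation β h fun F =>
      treeSum h (F.connectedComponentMk x) / (1 + treeSum h (F.connectedComponentMk x)) := by
  classical
  have hZ := partitionFunction_pos hβ hh
  have e : forestExpectation β h (fun F =>
      treeSum h (F.connectedComponentMk x) / (1 + treeSum h (F.connectedComponentMk x)))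
      = (∑ F ∈ forests β, (forestWeight β h F
        - (forestWeight β (h + Pi.single x 1) F - forestWeight β h F))) / partitionFunction β h := by
    rw [forestExpectation, Finset.sum_div]
    refine Finset.sum_congr rfl fun F _ => ?_
    have hpos : 0 < 1 + treeSum h (F.connectedComponentMk x) :=
      add_pos_of_pos_of_nonneg one_pos (treeSum_nonneg hh _)
    have hk : treeProd (fun T : F.ConnectedComponent => 1 + treeSum h T)
        = (1 + treeSum h (F.connectedComponentMk x)) * treeProd fun T : F.ConnectedComponent =>
          if T = F.connectedComponentMk x then 1 else 1 + treeSum h T := by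
      have h1 := Finset.mul_prod_erase Finset.univ
        (fun T : F.ConnectedComponent => 1 + treeSum h T)
        (Finset.mem_univ (F.connectedComponentMk x))
      have h2 := Finset.mul_prod_erase Finset.univ
        (fun T : F.ConnectedComponent => if T = F.connectedComponentMk x then 1 else 1 + treeSum h T)
        (Finset.mem_univ (F.connectedComponentMk x))
      rw [treeProd_eq, treeProd_eq, ← h1, ← h2, if_pos rfl, one_mul]
      congr 1
      exact Finset.prod_congr rfl fun T hT => (if_neg (Finset.ne_of_mem_erase hT)).symm
    rw [forestWeight_eq, forestWeight_eq, ← mul_sub, treeProd_add_single (fun _ => 1), hk]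
    field_simp
    ring
  rw [expectation_z, e, Finset.sum_sub_distrib, Finset.sum_sub_distrib]
  rfl

end SigmaModelForests

section RandomGreenFunction

variable {Λ : Type*} [DecidableEq Λ] [Fintype Λ]

/-! ### Integration by parts -/

/-- `W` is an even element with `∂_{η_i} W = θ W`. -/
def IsLogDeriv (i : Λ) (W : GrassmannCenter Λ) (θ : Grassmann Λ) : Prop :=
  ∀ y, dEta i (centerVal W * y) = θ * (centerVal W * y) + centerVal W * dEta i y

theorem IsLogDeriv.mul {i : Λ} {W W' : GrassmannCenter Λ} {θ θ' : Grassmann Λ}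
    (h : IsLogDeriv i W θ) (h' : IsLogDeriv i W' θ') : IsLogDeriv i (W * W') (θ + θ') := by
  intro y
  rw [map_mul centerVal, mul_assoc, h, h', mul_add, add_mul, add_assoc, ← mul_assoc _ θ',
    centerVal_commute W θ', mul_assoc θ', mul_assoc]

theorem IsLogDeriv.prod {ι : Type*} {i : Λ} (s : Finset ι) {W : ι → GrassmannCenter Λ}
    {θ : ι → Grassmann Λ} (h : ∀ k ∈ s, IsLogDeriv i (W k) (θ k)) :
    IsLogDeriv i (∏ k ∈ s, W k) (∑ k ∈ s, θ k) := by
  classical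
  induction s using Finset.induction_on with
  | empty => intro y; simp
  | insert a s ha ih =>
    rw [Finset.prod_insert ha, Finset.sum_insert ha]
    exact (h a (Finset.mem_insert_self _ _)).mul
      (ih fun k hk => h k (Finset.mem_insert_of_mem hk))

theorem isLogDeriv_siteElt (i : Λ) (h : ℝ) (k : Λ) :
    IsLogDeriv i (siteElt 1 h k) (if k = i then -(h • xi i) else 0) := by
  intro y
  by_cases hk : k = i
  · subst hk
    have e : xi k * (centerVal (pair k k) * y) = 0 := by
      rw [← mul_assoc, ← centerVal_commute, pair_mul_xi_self, zero_mul]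
    rw [if_pos rfl, centerVal_siteElt_mul, centerVal_siteElt_mul, map_add, map_smul, map_smul,
      dEta_pair_mul, if_pos rfl, mul_add, neg_mul, neg_mul, smul_mul_assoc, smul_mul_assoc,
      mul_smul_comm, mul_smul_comm, e]
    simp only [one_smul, smul_zero, neg_zero, smul_add, smul_neg]
    abel
  · rw [dEta_siteElt_mul hk, if_neg hk, zero_mul, zero_add]

theorem dEta_bond_mul_of_ne {i j k : Λ} (hj : j ≠ i) (hk : k ≠ i) (c : ℝ) (y : Grassmann Λ) :
    dEta i (centerVal (bond c j k) * y) = centerVal (bond c j k) * dEta i y := by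
  rw [centerVal_bond_mul, centerVal_bond_mul]
  simp only [map_add, map_sub, map_smul, dEta_pair_mul, if_neg hj, if_neg hk, neg_zero, zero_add]

theorem dEta_bond_mul {i j : Λ} (hj : j ≠ i) (y : Grassmann Λ) :
    dEta i (centerVal (bond 0 i j) * y)
      = -((xi i - xi j) * y) + centerVal (bond 0 i j) * dEta i y := by
  rw [centerVal_bond_mul, centerVal_bond_mul]
  simp only [map_add, map_sub, dEta_pair_mul, if_neg hj, if_true, neg_zero, zero_add,
    zero_smul, sub_zero, sub_mul]
  abel

/-- The derivative of `1 + b f` is `b θ`, which equals `b θ (1 + b f)` because `θ f = 0`. -/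
theorem isLogDeriv_one_add_smul {i : Λ} {f : GrassmannCenter Λ} {θ : Grassmann Λ}
    (hf : ∀ y, dEta i (centerVal f * y) = θ * y + centerVal f * dEta i y)
    (hθ : ∀ y, θ * (centerVal f * y) = 0) (b : ℝ) : IsLogDeriv i (1 + b • f) (b • θ) := by
  intro y
  rw [map_add, map_one, add_mul, add_mul, one_mul, one_mul, centerVal_smul, smul_mul_assoc,
    smul_mul_assoc, smul_mul_assoc, map_add, map_smul, hf, mul_add, mul_smul_comm, hθ]
  simp only [smul_add, smul_zero, add_zero]
  abel

/-- Inside `C` the bond constant is 0, so the bond is purely quadratic and its logarithmic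
derivative is linear in `ξ`. Edges not containing `i` give zero; the sum over `j` selects the other
endpoint, if there is one. -/
theorem isLogDeriv_edgeBond {C : Finset Λ} {i : Λ} (hi : i ∈ C) (β : Sym2 Λ → ℝ) {e : Sym2 Λ}
    (he : e ∈ splitEdges C) : IsLogDeriv i (1 + β e • edgeBond C e)
      (∑ j ∈ C.erase i, if e = s(i, j) then -(β e • (xi i - xi j)) else 0) := by
  have hoff : offMass C i = 0 := if_pos hi
  by_cases hmem : ∃ j ∈ C.erase i, e = s(i, j)
  · obtain ⟨j, hj, rfl⟩ := hmem
    have hji := Finset.ne_of_mem_erase hj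
    have hsum : (∑ k ∈ C.erase i, if s(i, j) = s(i, k) then -(β s(i, j) • (xi i - xi k)) else 0)
        = β s(i, j) • (-(xi i - xi j)) := by
      rw [Finset.sum_eq_single_of_mem j hj, if_pos rfl, smul_neg]
      intro k _ hk
      rw [if_neg]
      rw [Sym2.congr_right]
      exact hk.symm
    rw [hsum, edgeBond_mk, hoff, zero_mul]
    refine isLogDeriv_one_add_smul (fun y => ?_) (fun y => ?_) _
    · rw [dEta_bond_mul hji, neg_mul]
    · rw [neg_mul, ← mul_assoc, ← centerVal_commute, mul_sub, bond_mul_xi, sub_self, zero_mul,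
        neg_zero]
  · push Not at hmem
    rw [Finset.sum_eq_zero fun j hj => if_neg (hmem j hj), ← smul_zero (β e)]
    refine isLogDeriv_one_add_smul (fun y => ?_) (fun y => zero_mul _) _
    rw [zero_mul, zero_add]
    induction e using Sym2.ind with
    | _ j k =>
      obtain ⟨hjk, hC⟩ := mk_mem_splitEdges.1 he
      refine dEta_bond_mul_of_ne ?_ ?_ _ _
      · rintro rfl
        exact hmem k (Finset.mem_erase.2 ⟨hjk.symm, hC.1 hi⟩) rfl
      · rintro rfl
        exact hmem j (Finset.mem_erase.2 ⟨hjk, hC.2 hi⟩) Sym2.eq_swap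

theorem isLogDeriv_boltzmann {C : Finset Λ} {i : Λ} (hi : i ∈ C) (β : Sym2 Λ → ℝ) (h : Λ → ℝ) :
    IsLogDeriv i (boltzmann C β h)
      (-(∑ j ∈ C, β s(i, j) • (xi i - xi j)) - h i • xi i) := by
  have h1 := IsLogDeriv.prod (splitEdges C) fun e he => isLogDeriv_edgeBond hi β he
  have h2 := IsLogDeriv.prod Finset.univ fun k _ => isLogDeriv_siteElt i (h k) k
  have e1 : (∑ e ∈ splitEdges C, ∑ j ∈ C.erase i,
      if e = s(i, j) then -(β e • (xi i - xi j)) else 0)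
      = -(∑ j ∈ C, β s(i, j) • (xi i - xi j)) := by
    rw [Finset.sum_comm, ← Finset.add_sum_erase C _ hi, sub_self, smul_zero, zero_add,
      ← Finset.sum_neg_distrib]
    refine Finset.sum_congr rfl fun j hj => ?_
    rw [Finset.sum_ite_eq' (splitEdges C) s(i, j), if_pos]
    exact mk_mem_splitEdges.2 ⟨(Finset.ne_of_mem_erase hj).symm,
      iff_of_true hi (Finset.mem_of_mem_erase hj)⟩
  have e2 : (∑ k : Λ, if k = i then -(h k • xi i) else 0) = -(h i • xi i) := by
    rw [Finset.sum_ite_eq' Finset.univ i, if_pos (Finset.mem_univ _)]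
  have h3 := h1.mul h2
  rw [e1, e2, ← sub_eq_add_neg] at h3
  exact h3

/-- At mass zero the site weight is a scalar, so a total derivative integrates to zero by `∂_η² =
0`. This is where the Gaussian nature of the model inside `C` enters. -/
theorem gint_dEta {c μ : Λ → ℝ} {i : Λ} (hμ : μ i = 0) (F : Grassmann Λ) :
    gint c μ (dEta i F) = 0 := by
  rw [← map_zero (gint c μ)]
  refine gint_congr_of_siteOp i (fun _ _ => rfl) (fun _ _ => rfl) ?_
  rw [siteOp_apply, centerVal_siteElt_mul, hμ, zero_smul, add_zero, map_smul, map_smul, dXi_dEta,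
    map_neg, dEta_dEta_self, neg_zero, smul_zero, map_zero]

/-- The two-point function `[ξ_i η_x]` in the model that is split along `C`. -/
def splitGreen (C : Finset Λ) (β : Sym2 Λ → ℝ) (h : Λ → ℝ) (x i : Λ) : ℝ :=
  gint (fun _ => 1) (offMass C) (centerVal (pair i x * boltzmann C β h))

/-- The two-point function is a multiple of the Green function of the Laplacian on `C`. -/
theorem splitGreen_eq {C : Finset Λ} {i : Λ} (hi : i ∈ C) (β : Sym2 Λ → ℝ) (h : Λ → ℝ) (x : Λ) :
    ∑ j ∈ C, β s(i, j) * (splitGreen C β h x i - splitGreen C β h x j)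
        + h i * splitGreen C β h x i
      = if i = x then splitPartition C β h else 0 := by
  -- Integration by parts of `∂_{η_i}` applied to `η_x` times the Boltzmann weight: the derivative
  -- of `η_x` gives the source term, that of the weight gives the Laplacian.
  have h0 := gint_dEta (c := fun _ => 1) (μ := offMass C) (if_pos hi)
    (eta x * (centerVal (boltzmann C β h) * 1))
  have hg : ∀ j, gint (fun _ => 1) (offMass C) (eta x * (xi j * centerVal (boltzmann C β h)))
      = -splitGreen C β h x j := by
    intro j
    rw [splitGreen, map_mul centerVal, centerVal_pair, ← mul_assoc, eta_mul_xi, neg_mul, map_neg]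
  have hd : dEta i (1 : Grassmann Λ) = 0 := by simpa using dEta_algebraMap i 1
  rw [dEta_eta_mul, isLogDeriv_boltzmann hi, hd, mul_zero, add_zero, mul_one, sub_mul, neg_mul,
    Finset.sum_mul, mul_sub, mul_neg, Finset.mul_sum] at h0
  simp only [smul_mul_assoc, mul_smul_comm, sub_mul, mul_sub, map_sub, map_neg, map_sum, map_smul,
    hg, smul_eq_mul] at h0
  rw [apply_ite (gint (fun _ => 1) (offMass C)), map_zero, ← splitPartition] at h0
  have hs : ∑ j ∈ C, (β s(i, j) * -splitGreen C β h x i - β s(i, j) * -splitGreen C β h x j)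
      = -∑ j ∈ C, β s(i, j) * (splitGreen C β h x i - splitGreen C β h x j) := by
    rw [← Finset.sum_neg_distrib]
    exact Finset.sum_congr rfl fun j _ => by ring
  rw [hs] at h0
  rw [if_congr (@eq_comm _ i x) rfl rfl]
  linarith

theorem splitGreen_self (C : Finset Λ) (β : Sym2 Λ → ℝ) (h : Λ → ℝ) (x : Λ) :
    splitGreen C β h x x = splitPartition C β (h + Pi.single x 1) - splitPartition C β h :=
  gint_pair_mul_boltzmann C β h x

/-! ### The Dirichlet form -/

/-- The Dirichlet form on `C` with conductances `β` and killing rates `h`. -/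
def dirichlet (C : Finset Λ) (β : Sym2 Λ → ℝ) (h u v : Λ → ℝ) : ℝ :=
  1 / 2 * ∑ i ∈ C, ∑ j ∈ C, β s(i, j) * ((u i - u j) * (v i - v j)) + ∑ i ∈ C, h i * (u i * v i)

/-- Summation by parts, using the symmetry of `β`. -/
theorem dirichlet_eq (C : Finset Λ) (β : Sym2 Λ → ℝ) (h u v : Λ → ℝ) : dirichlet C β h u v
    = ∑ i ∈ C, u i * (∑ j ∈ C, β s(i, j) * (v i - v j) + h i * v i) := by
  have h1 : ∑ i ∈ C, ∑ j ∈ C, β s(i, j) * (u j * (v j - v i))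
      = ∑ i ∈ C, ∑ j ∈ C, β s(i, j) * (u i * (v i - v j)) := by
    rw [Finset.sum_comm]
    refine Finset.sum_congr rfl fun i _ => Finset.sum_congr rfl fun j _ => ?_
    rw [Sym2.eq_swap]
  have h2 : ∑ i ∈ C, ∑ j ∈ C, β s(i, j) * ((u i - u j) * (v i - v j))
      = 2 * ∑ i ∈ C, ∑ j ∈ C, β s(i, j) * (u i * (v i - v j)) := by
    rw [two_mul]
    nth_rewrite 2 [← h1]
    simp only [← Finset.sum_add_distrib]
    refine Finset.sum_congr rfl fun i _ => Finset.sum_congr rfl fun j _ => ?_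
    ring
  rw [dirichlet, h2, ← mul_assoc, one_div, inv_mul_cancel₀ two_ne_zero, one_mul,
    ← Finset.sum_add_distrib]
  refine Finset.sum_congr rfl fun i _ => ?_
  rw [mul_add, Finset.mul_sum]
  congr 1
  · exact Finset.sum_congr rfl fun j _ => by ring
  · ring

theorem dirichlet_nonneg (C : Finset Λ) {β : Sym2 Λ → ℝ} (hβ : ∀ e, 0 ≤ β e) {h : Λ → ℝ}
    (hh : ∀ i, 0 ≤ h i) (u : Λ → ℝ) : 0 ≤ dirichlet C β h u u :=
  add_nonneg (mul_nonneg (by norm_num) (Finset.sum_nonneg fun i _ => Finset.sum_nonneg fun j _ =>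
    mul_nonneg (hβ _) (mul_self_nonneg _)))
    (Finset.sum_nonneg fun i _ => mul_nonneg (hh i) (mul_self_nonneg _))

theorem dirichlet_sub_smul (C : Finset Λ) (β : Sym2 Λ → ℝ) (h u v : Λ → ℝ) (c : ℝ) :
    dirichlet C β h (fun i => u i - c * v i) (fun i => u i - c * v i)
      = dirichlet C β h u u - 2 * c * dirichlet C β h v u + c ^ 2 * dirichlet C β h v v := by
  simp only [dirichlet, mul_add, Finset.mul_sum]
  rw [← sub_eq_zero]
  have e : ∀ a b a' b' c d e f : ℝ, a + b - (a' + b' - (c + d) + (e + f))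
      = (a - a' + c - e) + (b - b' + d - f) := fun _ _ _ _ _ _ _ _ => by ring
  rw [e]
  simp only [← Finset.sum_add_distrib, ← Finset.sum_sub_distrib]
  have e1 : ∀ i j, 1 / 2 * (β s(i, j) * ((u i - c * v i - (u j - c * v j)) *
        (u i - c * v i - (u j - c * v j))))
      - 1 / 2 * (β s(i, j) * ((u i - u j) * (u i - u j)))
      + 2 * c * (1 / 2 * (β s(i, j) * ((v i - v j) * (u i - u j))))
      - c ^ 2 * (1 / 2 * (β s(i, j) * ((v i - v j) * (v i - v j)))) = 0 := fun i j => by ring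
  have e2 : ∀ i, h i * ((u i - c * v i) * (u i - c * v i)) - h i * (u i * u i)
      + 2 * c * (h i * (v i * u i)) - c ^ 2 * (h i * (v i * v i)) = 0 := fun i => by ring
  simp only [e1, e2, Finset.sum_const_zero, add_zero]

/-- The Dirichlet principle. -/
theorem dirichlet_principle {C : Finset Λ} {β : Sym2 Λ → ℝ} (hβ : ∀ e, 0 ≤ β e) {h : Λ → ℝ}
    (hh : ∀ i, 0 ≤ h i) {x : Λ} (hx : x ∈ C) {φ : Λ → ℝ} {c : ℝ} (hc : 0 ≤ c) (hφx : 0 ≤ φ x)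
    (hφ : ∀ i ∈ C, ∑ j ∈ C, β s(i, j) * (φ i - φ j) + h i * φ i = if i = x then c else 0)
    (w : Λ → ℝ) : c * (2 * w x - dirichlet C β h w w) ≤ φ x := by
  have key : ∀ u, dirichlet C β h u φ = u x * c := by
    intro u
    rw [dirichlet_eq, Finset.sum_eq_single_of_mem x hx, hφ x hx, if_pos rfl]
    intro i hi hix
    rw [hφ i hi, if_neg hix, mul_zero]
  -- For `c = 0` there is nothing to divide by and the claim is `0 ≤ φ x`. For `c > 0` it is the
  -- positivity of the form at `φ - c w`, divided by `c`.
  rcases hc.eq_or_lt with rfl | hc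
  · rwa [zero_mul]
  · have h1 := dirichlet_nonneg C hβ hh fun i => φ i - c * w i
    rw [dirichlet_sub_smul, key, key] at h1
    refine le_of_mul_le_mul_right ?_ hc
    nlinarith

/-! ### Averaging over the set of rooted vertices -/

theorem restrict_add_single {C : Finset Λ} (h : Λ → ℝ) {x : Λ} (hx : x ∈ C) :
    restrict C (h + Pi.single x 1) = restrict C h + Pi.single x 1 := by
  funext i
  by_cases hi : i ∈ C
  · simp [restrict, hi]
  · have : i ≠ x := fun hix => hi (hix ▸ hx)
    simp [restrict, hi, this]

theorem restrict_add_single_of_notMem {C : Finset Λ} (h : Λ → ℝ) {x : Λ} (hx : x ∉ C) :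
    restrict C (h + Pi.single x 1) = restrict C h := by
  funext i
  by_cases hi : i ∈ C
  · have : i ≠ x := fun hix => hx (hix ▸ hi)
    simp [restrict, hi, this]
  · simp [restrict, hi]

/-- Comparison of the random Green function with a test function `w`, when all vertices have the
same probability of being rooted. -/
theorem partitionFunction_dirichlet_le {β : Sym2 Λ → ℝ} (hβ : ∀ e, 0 ≤ β e) {h : Λ → ℝ}
    (hh : ∀ i, 0 ≤ h i) {D : ℝ}
    (hD : ∀ i, partitionFunction β (h + Pi.single i 1) - partitionFunction β h = D) (x : Λ)
    (w : Λ → ℝ) :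
    (partitionFunction β h - D) * (2 * w x - dirichlet Finset.univ β h w w) ≤ D := by
  set Z := partitionFunction β h with hZ
  let Φ : Finset Λ → ℝ := fun C => splitPartition C β (restrict C h)
  have hr : ∀ (C : Finset Λ) i, 0 ≤ restrict C h i := by
    intro C i
    unfold restrict
    split_ifs
    exacts [hh i, le_rfl]
  have hΦ : ∀ C, 0 ≤ Φ C := fun C => splitPartition_nonneg hβ (hr C) C
  -- In probabilistic terms, `Z - D` is `Z · P(i ∈ C)`.
  have hP : ∀ i, ∑ C : Finset Λ, (if i ∈ C then Φ C else 0) = Z - D := by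
    intro i
    have h1 := sum_splitPartition_notMem_eq β h i
    rw [hD] at h1
    rw [hZ, ← sum_splitPartition, ← h1, ← Finset.sum_sub_distrib]
    refine Finset.sum_congr rfl fun C _ => ?_
    split_ifs <;> simp [Φ]
  -- Raising the field at `x` only affects the sets `C` that contain `x`, where the change is the
  -- two-point function.
  have h1 : D = ∑ C : Finset Λ, (if x ∈ C then splitGreen C β (restrict C h) x x else 0) := by
    rw [← hD x, hZ, ← sum_splitPartition, ← sum_splitPartition, ← Finset.sum_sub_distrib]
    refine Finset.sum_congr rfl fun C _ => ?_
    split_ifs with hx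
    · rw [splitGreen_self, restrict_add_single h hx]
    · rw [restrict_add_single_of_notMem h hx, sub_self]
  -- Sets without `x` enter with the nonpositive term `-Φ(C) E_C(w,w)`. Keeping them makes the
  -- average of the Dirichlet form unconditional.
  have h2 : ∑ C : Finset Λ, ((if x ∈ C then Φ C else 0) * (2 * w x)
      - Φ C * dirichlet C β (restrict C h) w w) ≤ D := by
    rw [h1]
    refine Finset.sum_le_sum fun C _ => ?_
    split_ifs with hx
    · rw [← mul_sub]
      refine dirichlet_principle hβ (hr C) hx (hΦ C) ?_
        (fun i hi => splitGreen_eq hi β (restrict C h) x) w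
      rw [splitGreen_self, sub_nonneg]
      exact splitPartition_le_add_single hβ (hr C) C x
    · rw [zero_mul, zero_sub, neg_nonpos]
      exact mul_nonneg (hΦ C) (dirichlet_nonneg C hβ (hr C) w)
  rw [Finset.sum_sub_distrib, ← Finset.sum_mul, hP] at h2
  have h3 : ∑ C : Finset Λ, Φ C * dirichlet C β (restrict C h) w w
      ≤ (Z - D) * dirichlet Finset.univ β h w w := by
    have e1 : ∀ C : Finset Λ, Φ C * dirichlet C β (restrict C h) w w
        = 1 / 2 * ∑ i, ∑ j, β s(i, j) * ((w i - w j) * (w i - w j))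
            * (if i ∈ C then if j ∈ C then Φ C else 0 else 0)
          + ∑ i, h i * (w i * w i) * (if i ∈ C then Φ C else 0) := by
      intro C
      have ef : ∀ f : Λ → ℝ, ∑ i ∈ C, f i = ∑ i, if i ∈ C then f i else 0 := fun f => by
        rw [← Finset.sum_filter, Finset.filter_mem_eq_inter, Finset.univ_inter]
      rw [dirichlet, mul_add, mul_left_comm, ef, ef]
      congr 1
      · congr 1
        rw [Finset.mul_sum]
        refine Finset.sum_congr rfl fun i _ => ?_
        split_ifs with hi
        · rw [ef, Finset.mul_sum]
          refine Finset.sum_congr rfl fun j _ => ?_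
          split_ifs <;> ring
        · simp
      · rw [Finset.mul_sum]
        refine Finset.sum_congr rfl fun i _ => ?_
        split_ifs with hi
        · rw [restrict, if_pos hi]
          ring
        · simp
    -- The only loss in the averaging of the Dirichlet form: `P(i, j ∈ C) ≤ P(i ∈ C)`.
    have e2 : ∑ C : Finset Λ, ∑ i, ∑ j, β s(i, j) * ((w i - w j) * (w i - w j))
          * (if i ∈ C then if j ∈ C then Φ C else 0 else 0)
        ≤ (Z - D) * ∑ i, ∑ j, β s(i, j) * ((w i - w j) * (w i - w j)) := by
      rw [Finset.sum_comm, Finset.mul_sum]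
      refine Finset.sum_le_sum fun i _ => ?_
      rw [Finset.sum_comm, Finset.mul_sum]
      refine Finset.sum_le_sum fun j _ => ?_
      rw [← Finset.mul_sum, mul_comm (Z - D)]
      refine mul_le_mul_of_nonneg_left ?_ (mul_nonneg (hβ _) (mul_self_nonneg _))
      rw [← hP i]
      refine Finset.sum_le_sum fun C _ => ?_
      split_ifs
      exacts [le_rfl, hΦ C, le_rfl]
    have e3 : ∑ C : Finset Λ, ∑ i, h i * (w i * w i) * (if i ∈ C then Φ C else 0)
        = (Z - D) * ∑ i, h i * (w i * w i) := by
      rw [Finset.sum_comm, Finset.mul_sum]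
      refine Finset.sum_congr rfl fun i _ => ?_
      rw [← Finset.mul_sum, hP, mul_comm]
    simp only [e1]
    rw [Finset.sum_add_distrib, ← Finset.mul_sum, e3, dirichlet]
    linarith
  rw [mul_sub]
  linarith

end RandomGreenFunction

section MerminWagner

/-! ### Relabelling of the vertices -/

section Relabel

variable {Λ : Type*} [Fintype Λ]

theorem edgeProd_iso {β : Sym2 Λ → ℝ} {F G : SimpleGraph Λ} (φ : F ≃g G)
    (hβ : ∀ i j, β s(φ i, φ j) = β s(i, j)) : edgeProd β F = edgeProd β G := by
  classical
  unfold edgeProd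
  refine Finset.prod_bij (fun e _ => e.map φ) (fun e he => ?_)
    (fun e _ e' _ h => Sym2.map.injective φ.injective h) (fun e he => ?_) (fun e _ => ?_)
  · induction e using Sym2.ind with
    | _ i j =>
      rw [SimpleGraph.mem_edgeFinset] at he ⊢
      exact φ.map_adj_iff.2 he
  · induction e using Sym2.ind with
    | _ i j =>
      rw [SimpleGraph.mem_edgeFinset] at he
      refine ⟨s(φ.symm i, φ.symm j), ?_, ?_⟩
      · rw [SimpleGraph.mem_edgeFinset]
        exact φ.symm.map_adj_iff.2 he
      · simp
  · induction e using Sym2.ind with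
    | _ i j => exact (hβ i j).symm

theorem treeSum_iso {h k : Λ → ℝ} {F G : SimpleGraph Λ} (φ : F ≃g G) (hk : ∀ i, h (φ i) = k i)
    (T : F.ConnectedComponent) : treeSum k T = treeSum h (φ.connectedComponentEquiv T) := by
  classical
  unfold treeSum
  refine Finset.sum_equiv φ.toEquiv (fun i => ?_) (fun i _ => (hk i).symm)
  simp only [Finset.mem_filter, Finset.mem_univ, true_and, SimpleGraph.ConnectedComponent.mem_supp_iff]
  rw [← φ.connectedComponentEquiv.apply_eq_iff_eq]
  rfl

theorem partitionFunction_relabel {β : Sym2 Λ → ℝ} {h k : Λ → ℝ} (σ : Λ ≃ Λ)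
    (hβ : ∀ i j, β s(σ i, σ j) = β s(i, j)) (hk : ∀ i, h (σ i) = k i) :
    partitionFunction β k = partitionFunction β h := by
  classical
  have e : ∀ g : Λ → ℝ, partitionFunction β g = ∑ F ∈ acyclicGraphs Λ,
      edgeProd β F * treeProd fun T : F.ConnectedComponent => 1 + treeSum g T := fun g =>
    sum_forests_eq_sum_acyclicGraphs β fun F =>
      treeProd fun T : F.ConnectedComponent => 1 + treeSum g T
  rw [e, e]
  refine Finset.sum_equiv σ.simpleGraph (fun F => ?_) (fun F _ => ?_)
  · rw [mem_acyclicGraphs, mem_acyclicGraphs]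
    exact (SimpleGraph.Iso.comap σ.symm F).isAcyclic_iff.symm
  · let φ : F ≃g σ.simpleGraph F := (SimpleGraph.Iso.comap σ.symm F).symm
    rw [edgeProd_iso φ hβ]
    congr 1
    exact Fintype.prod_equiv φ.connectedComponentEquiv _ _ fun T => by rw [treeSum_iso φ hk]

theorem forestExpectation_pos {β : Sym2 Λ → ℝ} (hβ : ∀ e, 0 ≤ β e) {h : Λ → ℝ}
    (hh : ∀ i, 0 ≤ h i) (hZ : 0 < partitionFunction β h) {X : SimpleGraph Λ → ℝ}
    (hX : ∀ F, 0 < X F) : 0 < forestExpectation β h X := by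
  have hw : ∀ F, 0 ≤ forestWeight β h F := fun F =>
    mul_nonneg (Finset.prod_nonneg fun e _ => hβ e)
      (treeProd_nonneg fun T => add_nonneg zero_le_one (treeSum_nonneg hh T))
  obtain ⟨F, hF, hF0⟩ := Finset.exists_ne_zero_of_sum_ne_zero hZ.ne'
  exact Finset.sum_pos' (fun F _ => mul_nonneg (div_nonneg (hw F) hZ.le) (hX F).le)
    ⟨F, hF, mul_pos (div_pos ((hw F).lt_of_ne' hF0) hZ) (hX F)⟩

end Relabel

/-! ### The Green function of the torus -/

section Torus

variable {d L : ℕ} [NeZero L]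

/-- The character of the torus with momentum `(2π / L) k`. -/
def torusChar (k j : Torus d L) : ℂ := ZMod.stdAddChar (k ⬝ᵥ j)

theorem torusChar_add (k i j : Torus d L) :
    torusChar k (i + j) = torusChar k i * torusChar k j := by
  rw [torusChar, dotProduct_add, AddChar.map_add_eq_mul]
  rfl

theorem torusChar_comm (k j : Torus d L) : torusChar k j = torusChar j k := by
  rw [torusChar, dotProduct_comm]
  rfl

theorem torusChar_zero (k : Torus d L) : torusChar k 0 = 1 := by
  rw [torusChar, dotProduct_zero, AddChar.map_zero_eq_one]

/-- The Euclidean product of representatives is `2π/L` times an integer that reduces to `k · j`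
modulo `L`. -/
theorem cos_momentum (k j : Torus d L) :
    Real.cos (((2 * Real.pi / L) • coords k) ⬝ᵥ coords j) = (torusChar k j).re := by
  have h1 : ((((∑ a, (k a).val * (j a).val : ℕ) : ℤ)) : ZMod L) = k ⬝ᵥ j := by
    push_cast
    simp [dotProduct]
  have h2 : ((2 * Real.pi / L) • coords k) ⬝ᵥ coords j
      = 2 * Real.pi * ((∑ a, (k a).val * (j a).val : ℕ) : ℝ) / L := by
    rw [smul_dotProduct, smul_eq_mul]
    simp only [dotProduct, coords]
    push_cast
    ring
  rw [torusChar, ← h1, ZMod.stdAddChar_coe, h2]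
  rw [← Complex.exp_ofReal_mul_I_re]
  congr 2
  push_cast
  ring

theorem torusChar_neg_im (k j : Torus d L) : (torusChar k (-j)).im = -(torusChar k j).im := by
  rw [torusChar, dotProduct_neg, AddChar.map_neg_eq_conj, Complex.conj_im]
  rfl

theorem sum_torusChar (j : Torus d L) :
    ∑ k : Torus d L, torusChar k j = if j = 0 then (L : ℂ) ^ d else 0 := by
  split_ifs with hj
  · subst hj
    simp [torusChar_zero, ZMod.card]
  · let ψ : AddChar (Torus d L) ℂ :=
      { toFun := fun k => torusChar j k
        map_zero_eq_one' := torusChar_zero j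
        map_add_eq_mul' := torusChar_add j }
    have hψ : ψ ≠ 0 := by
      obtain ⟨a, ha⟩ : ∃ a, j a ≠ 0 := by
        by_contra hne
        push Not at hne
        exact hj (funext hne)
      rw [AddChar.ne_zero_iff]
      refine ⟨Pi.single a 1, ?_⟩
      change ZMod.stdAddChar (j ⬝ᵥ Pi.single a 1) ≠ 1
      rw [dotProduct_single, mul_one, ← AddChar.map_zero_eq_one (ZMod.stdAddChar (N := L))]
      exact fun h => ha (ZMod.injective_stdAddChar h)
    have := AddChar.sum_eq_zero_iff_ne_zero.2 hψ
    simp only [torusChar_comm _ j]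
    exact this

/-- The eigenvalue `λ(p)` at `p = (2π / L) k`. -/
def eigenvalue (β : Sym2 (Torus d L) → ℝ) (k : Torus d L) : ℝ :=
  fourierMultiplier β ((2 * Real.pi / L) • coords k)

theorem eigenvalue_eq (β : Sym2 (Torus d L) → ℝ) (k : Torus d L) :
    eigenvalue β k = ∑ j, β s(0, j) * (1 - (torusChar k j).re) := by
  simp only [eigenvalue, fourierMultiplier, cos_momentum]

theorem eigenvalue_nonneg {β : Sym2 (Torus d L) → ℝ} (hβ : ∀ e, 0 ≤ β e) (k : Torus d L) :
    0 ≤ eigenvalue β k :=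
  Finset.sum_nonneg fun _ _ => mul_nonneg (hβ _) (sub_nonneg.2 (Real.cos_le_one _))

theorem laplacian_torusChar {β : Sym2 (Torus d L) → ℝ}
    (hinv : ∀ x i j : Torus d L, β s(x + i, x + j) = β s(i, j)) (k i : Torus d L) :
    ∑ j, β s(i, j) * ((torusChar k i).re - (torusChar k j).re)
      = eigenvalue β k * (torusChar k i).re := by
  have h1 : ∑ j, β s(i, j) * ((torusChar k i).re - (torusChar k j).re)
      = ∑ m, β s(0, m) * ((torusChar k i).re - (torusChar k (i + m)).re) := by
    rw [← Equiv.sum_comp (Equiv.addLeft i)]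
    refine Finset.sum_congr rfl fun m _ => ?_
    have := hinv i 0 m
    rw [add_zero] at this
    rw [Equiv.coe_addLeft, this]
  -- Symmetry and translation invariance give `β_{0,m} = β_{0,-m}`, so the odd sine part cancels and
  -- the real parts of characters are eigenfunctions.
  have h2 : ∑ m, β s(0, m) * (torusChar k m).im = 0 := by
    have : ∑ m, β s(0, m) * (torusChar k m).im = -∑ m, β s(0, m) * (torusChar k m).im := by
      rw [← Finset.sum_neg_distrib]
      conv_lhs => rw [← Equiv.sum_comp (Equiv.neg (Torus d L))]
      refine Finset.sum_congr rfl fun m _ => ?_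
      have := hinv m 0 (-m)
      rw [add_zero, add_neg_cancel, Sym2.eq_swap] at this
      rw [Equiv.neg_apply, torusChar_neg_im, ← this, mul_neg]
    linarith
  have h3 : ∑ m, β s(0, m) * ((torusChar k i).re - (torusChar k (i + m)).re)
      = (∑ m, β s(0, m) * (1 - (torusChar k m).re)) * (torusChar k i).re
        + (torusChar k i).im * ∑ m, β s(0, m) * (torusChar k m).im := by
    rw [Finset.sum_mul, Finset.mul_sum, ← Finset.sum_add_distrib]
    refine Finset.sum_congr rfl fun m _ => ?_
    rw [torusChar_add, Complex.mul_re]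
    ring
  rw [h1, h3, h2, mul_zero, add_zero, eigenvalue_eq]

/-- The Green function of the torus with mass `h`. -/
def torusGreen (β : Sym2 (Torus d L) → ℝ) (h : ℝ) (j : Torus d L) : ℝ :=
  1 / (L : ℝ) ^ d * ∑ k : Torus d L, (torusChar k j).re / (eigenvalue β k + h)

theorem laplacian_torusGreen {β : Sym2 (Torus d L) → ℝ} (hβ : ∀ e, 0 ≤ β e)
    (hinv : ∀ x i j : Torus d L, β s(x + i, x + j) = β s(i, j)) {h : ℝ} (hh : 0 < h)
    (i : Torus d L) :
    ∑ j, β s(i, j) * (torusGreen β h i - torusGreen β h j) + h * torusGreen β h i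
      = if i = 0 then 1 else 0 := by
  have hL : (L : ℝ) ^ d ≠ 0 := pow_ne_zero _ (Nat.cast_ne_zero.2 (NeZero.ne L))
  have h1 : ∑ j, β s(i, j) * (torusGreen β h i - torusGreen β h j)
      = 1 / (L : ℝ) ^ d * ∑ k : Torus d L,
        eigenvalue β k * (torusChar k i).re / (eigenvalue β k + h) := by
    simp only [← laplacian_torusChar hinv, torusGreen, ← mul_sub, ← Finset.sum_sub_distrib,
      Finset.sum_div, Finset.mul_sum]
    rw [Finset.sum_comm]
    refine Finset.sum_congr rfl fun k _ => Finset.sum_congr rfl fun _ _ => ?_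
    ring
  have h2 : ∑ k : Torus d L, (torusChar k i).re = if i = 0 then (L : ℝ) ^ d else 0 := by
    rw [← Complex.re_sum, sum_torusChar]
    split_ifs
    · rw [← Complex.ofReal_natCast, ← Complex.ofReal_pow, Complex.ofReal_re]
    · rfl
  have h3 : ∀ k : Torus d L, eigenvalue β k * (torusChar k i).re / (eigenvalue β k + h)
      + h * ((torusChar k i).re / (eigenvalue β k + h)) = (torusChar k i).re := by
    intro k
    have : eigenvalue β k + h ≠ 0 := (add_pos_of_nonneg_of_pos (eigenvalue_nonneg hβ k) hh).ne'
    field_simp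
  rw [h1, torusGreen, mul_left_comm, ← mul_add, Finset.mul_sum _ _ h, ← Finset.sum_add_distrib]
  simp only [h3]
  rw [h2]
  split_ifs
  · rw [one_div, inv_mul_cancel₀ hL]
  · rw [mul_zero]

theorem torusGreen_zero_eq (β : Sym2 (Torus d L) → ℝ) (h : ℝ) :
    torusGreen β h 0
      = 1 / (L : ℝ) ^ d * ∑ p ∈ dualTorus d L, 1 / (fourierMultiplier β p + h) := by
  have hinj : Function.Injective fun k : Torus d L => (2 * Real.pi / L) • coords k := by
    intro k k' hkk
    have hc : (2 * Real.pi / L : ℝ) ≠ 0 := by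
      have : (L : ℝ) ≠ 0 := Nat.cast_ne_zero.2 (NeZero.ne L)
      positivity
    have h1 := smul_right_injective _ hc hkk
    funext a
    exact ZMod.val_injective L (Nat.cast_injective (R := ℝ) (congrFun h1 a))
  rw [torusGreen, dualTorus, Finset.sum_image fun _ _ _ _ h => hinj h]
  simp only [torusChar_zero, Complex.one_re]
  rfl

end Torus

end MerminWagner

end ArborealGas

end

/-! ### Conclusion: the two claims on the torus -/

theorem mainTheorem2 (d L : ℕ) [NeZero L] (hd : 1 ≤ d)
    (β : Sym2 (ArborealGas.Torus d L) → ℝ) (hβ : ∀ e, 0 ≤ β e)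
    (hinv : ∀ x i j : ArborealGas.Torus d L, β s(x + i, x + j) = β s(i, j))
    (h : ℝ) (hh : 0 < h) :
    ArborealGas.expectation β (fun _ => h) (ArborealGas.z 0) =
        ArborealGas.forestExpectation β (fun _ => h)
          (fun F => h * (ArborealGas.treeSize F 0 : ℝ) / (1 + h * (ArborealGas.treeSize F 0 : ℝ))) ∧
      1 / ArborealGas.expectation β (fun _ => h) (ArborealGas.z 0) ≥
        1 + 1 / (2 * Real.pi * L) ^ d *
          ∑ p ∈ ArborealGas.dualTorus d L, 1 / (ArborealGas.fourierMultiplier β p + h) := by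
  open ArborealGas in
  have hh' : ∀ i : Torus d L, 0 ≤ (fun _ => h : Torus d L → ℝ) i := fun _ => hh.le
  have hE := expectation_z_eq_forestExpectation hβ hh' 0
  simp only [treeSum_const] at hE
  refine ⟨hE, ?_⟩
  have hZ := partitionFunction_pos hβ hh'
  have hpos : 0 < expectation β (fun _ => h) (z 0) := by
    rw [hE]
    refine forestExpectation_pos hβ hh' hZ fun F => ?_
    have hT : 0 < treeSize F 0 := (Set.ncard_pos (Set.toFinite _)).2 ⟨0, rfl⟩
    positivity
  set Z := partitionFunction β (fun _ : Torus d L => h) with hZdef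
  set D := partitionFunction β ((fun _ => h) + Pi.single (0 : Torus d L) 1) - Z with hDdef
  have hD : ∀ i : Torus d L,
      partitionFunction β ((fun _ => h) + Pi.single i 1) - partitionFunction β (fun _ => h) = D := by
    intro i
    rw [hDdef]
    congr 1
    -- Translation by `i` moves the unit increment from `0` to `i`.
    refine (partitionFunction_relabel (Equiv.addLeft i) (fun j k => hinv i j k) fun j => ?_).symm
    simp [Pi.single_apply]
  have hle := partitionFunction_dirichlet_le hβ hh' hD 0 (torusGreen β h)
  -- The torus Green function solves the massive Laplace equation with unit source at 0, so its
  -- Dirichlet energy is its value there; it makes the lower bound as large as possible.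
  have hdir : dirichlet Finset.univ β (fun _ => h) (torusGreen β h) (torusGreen β h)
      = torusGreen β h 0 := by
    rw [dirichlet_eq]
    simp [laplacian_torusGreen hβ hinv hh]
  rw [hdir, two_mul, add_sub_cancel_right, ← hZdef] at hle
  rw [expectation_z, ← hZdef, ← hDdef] at hpos ⊢
  have hZD : 0 < Z - D := by
    have := mul_pos hpos hZ
    rwa [div_mul_cancel₀ _ hZ.ne'] at this
  have hS : 0 ≤ ∑ p ∈ dualTorus d L, 1 / (fourierMultiplier β p + h) := by
    refine Finset.sum_nonneg fun p _ => one_div_nonneg.2 (add_nonneg ?_ hh.le)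
    exact Finset.sum_nonneg fun j _ => mul_nonneg (hβ _) (sub_nonneg.2 (Real.cos_le_one _))
  have hLpos : (0 : ℝ) < L := Nat.cast_pos.2 (NeZero.pos L)
  -- The argument gives the bound with `L^{-d}`; since `2π ≥ 1`, the stated prefactor is smaller.
  have hc : 1 / (2 * Real.pi * L) ^ d ≤ 1 / (L : ℝ) ^ d := by
    refine one_div_le_one_div_of_le (pow_pos hLpos d) (pow_le_pow_left₀ hLpos.le ?_ d)
    have := Real.pi_gt_three
    nlinarith
  have hfin : 1 + torusGreen β h 0 ≤ 1 / ((Z - D) / Z) := by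
    rw [one_div_div, le_div_iff₀ hZD]
    linarith
  refine ge_iff_le.2 (le_trans ?_ hfin)
  rw [torusGreen_zero_eq]
  exact add_le_add_right (mul_le_mul_of_nonneg_right hc hS) 1
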